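/- Consider a massless (real or complex) right-moving scalar field on the CGHS black-hole space-time with $M=\lambda=1$ and $x_o^+=0$, for which the incoming and outgoing coordinates are related by $x(y)=-\log(1+e^{-y})$. Let $\phi(x)=\frac1{\sqrt{2\pi}}\int_0^\infty\frac{dk}{2k}\,[a(k)e^{-ikx}+b^\dagger(k)e^{ikx}]$ be the incoming field, where $[a(k),a^\dagger(k')]=2k\,\delta(k-k')$, $b=a$ for the real field, and $b$ is an independent antiparticle operator with the same commutation relation for the complex field. Let $\hat\phi(y)=\phi(x(y))$ be the outgoing field and $\hat\phi[f]=\int f(y)\hat\phi(y)\,dy$. For a test function $f$ let $\bar N_o[f]\in[0,\infty]$ be the mean value of $\hat\phi[f]^\dagger\hat\phi[f]$ in the incoming vacuum, and $\bar N^{Th}_{\beta,in}[f]\in[0,\infty]$ its mean value in the incoming thermal state of inverse temperature $\beta$. The thermal mean is the limit of the Gibbs means $\mathrm{Tr}(e^{-\beta H}A)/\mathrm{Tr}(e^{-\beta H})$ for finitely many incoming momentum modes (wave packets on momentum cells of width $1/m$ between $1/m$ and $\Lambda+1/m$) as the resolution $m$ and the cutoff $\Lambda$ tend to infinity; the vacuum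 mean is obtained as the same limit of vacuum means. Let $\tilde f(p)=\frac1{\sqrt{2\pi}}\int_{-\infty}^{\infty}f(y)e^{-ipy}\,dy$ and $f_{y_o}(y)=f(y-y_o)$. **Theorem.** Let $\beta>0$ and let $f:\mathbb R\to\mathbb C$ be integrable, with $\tilde f(p)=0$ for $p<0$ and $\int_0^\infty\frac{dp}{2p}|\tilde f(p)|^2=1$. Suppose there are constants $\alpha>1/2$, $C>0$, $L\ge1$ with $|f(y)|\le C/|y|^{1+\alpha}$ for almost every $y\le-L$. Put $I=\int_0^\infty\frac{dp}{2p}\,\frac{|\tilde f(p)|^2}{1-e^{-2\pi p}}\in[0,\infty]$. Then the limits defining $\bar N^{Th}_{\beta,in}[f_{y_o}]$ and $\bar N_o[f_{y_o}]$ exist in $[0,\infty]$ for every real $y_o$, and for all $y_o>0$ $$\left|\bar N^{Th}_{\beta,in}[f_{y_o}]-\bar N_o[f_{y_o}]\right|\le\frac{C^2}{\beta\,\alpha^2(2\alpha-1)\left(\frac12y_o+L\right)^{2\alpha-1}}+\frac{4\pi}{\beta}\,e^{L-y_o/2}\,I ,$$ where, for values in $[0,\infty]$, $|a-b|\le R$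 means $a\le b+R$ and $b\le a+R$. If $I<\infty$, then both numbers are finite for every $y_o>0$, and consequently $\lim_{y_o\to+\infty}\left(\bar N^{Th}_{\beta,in}[f_{y_o}]-\bar N_o[f_{y_o}]\right)=0$. -/

import Mathlib

open Filter Topology MeasureTheory Set
open scoped ENNReal

noncomputable section

namespace CGHS

/-! ### Bosonic Fock space over finitely many modes (finite-particle vectors) -/

/-- Finite-particle vectors of the bosonic Fock space over the modes `κ`: finite combinations of the
orthonormal occupation-number vectors `|n⟩`, `n : κ → ℕ`. -/
abbrev Fock (κ : Type) : Type := (κ → ℕ) →₀ ℂ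

/-- The occupation-number vector `|n⟩`. -/
def ket {κ : Type} (n : κ → ℕ) : Fock κ := Finsupp.single n 1

/-- `a_i |n⟩ = √(n_i) |n - e_i⟩` (which is zero if `n_i = 0`). -/
def annihilation {κ : Type} [DecidableEq κ] (i : κ) : Fock κ →ₗ[ℂ] Fock κ :=
  Finsupp.linearCombination ℂ fun n : κ → ℕ =>
    ((Real.sqrt (n i) : ℝ) : ℂ) • ket (n - Pi.single i 1)

/-- `a_i† |n⟩ = √(n_i + 1) |n + e_i⟩`. -/
def creation {κ : Type} [DecidableEq κ] (i : κ) : Fock κ →ₗ[ℂ] Fock κ :=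
  Finsupp.linearCombination ℂ fun n : κ → ℕ =>
    ((Real.sqrt (n i + 1) : ℝ) : ℂ) • ket (n + Pi.single i 1)

/-- The eigenvalue `∑ i, n_i ω_i` of the Hamiltonian `∑ i, ω_i a_i† a_i` on `|n⟩`. -/
def energy {κ : Type} [Fintype κ] (ω : κ → ℝ) (n : κ → ℕ) : ℝ := ∑ i, (n i : ℝ) * ω i

/-- The vacuum mean `⟨0| A |0⟩`. -/
def vacuumMean {κ : Type} (A : Fock κ →ₗ[ℂ] Fock κ) : ℂ := A (ket 0) 0

/-- The thermal mean `Tr (e^{-βH} A) / Tr e^{-βH}` with `H = ∑ i, ω_i a_i† a_i`; the traces are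
taken in the basis `|n⟩`. -/
def gibbsMean {κ : Type} [Fintype κ] (β : ℝ) (ω : κ → ℝ) (A : Fock κ →ₗ[ℂ] Fock κ) : ℂ :=
  (∑' n : κ → ℕ, ((Real.exp (-(β * energy ω n)) : ℝ) : ℂ) * A (ket n) n) /
    ∑' n : κ → ℕ, ((Real.exp (-(β * energy ω n)) : ℝ) : ℂ)

/-! ### Test functions -/

/-- The incoming coordinate as a function of the outgoing one, for the CGHS black hole
(`M = λ = 1`, `x_o^+ = 0`). -/
def xIn (y : ℝ) : ℝ := -Real.log (1 + Real.exp (-y))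

/-- Outgoing momentum representation `f~(p) = (2π)^{-1/2} ∫ f(y) e^{-ipy} dy`. -/
def outFT (f : ℝ → ℂ) (p : ℝ) : ℂ :=
  ((Real.sqrt (2 * Real.pi))⁻¹ : ℝ) * ∫ y : ℝ, Complex.exp (-(Complex.I * p * y)) * f y

/-- Incoming momentum representation of the same test function,
`(U f~)(k) = (2π)^{-1/2} ∫ f(y) e^{-ikx(y)} dy`, where `U` has the kernel
`U(k,p) = (2π)⁻¹ ∫ e^{-ikx(y)} e^{ipy} dy`. -/
def inFT (f : ℝ → ℂ) (k : ℝ) : ℂ :=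
  ((Real.sqrt (2 * Real.pi))⁻¹ : ℝ) * ∫ y : ℝ, Complex.exp (-(Complex.I * k * xIn y)) * f y

/-- The translate `f_{y_o}(y) = f(y - y_o)`. -/
def shift (f : ℝ → ℂ) (yo : ℝ) : ℝ → ℂ := fun y => f (y - yo)

/-- `f` is an integrable function whose momentum representation `f~` is supported on `ℝ₊` and is a
normalized element of `L²(dp/2p, ℝ₊)`. -/
structure IsNormalizedWave (f : ℝ → ℂ) : Prop where
  integrable : Integrable f
  positive_momentum : ∀ p < 0, outFT f p = 0
  normalized : ∫⁻ p in Ioi (0 : ℝ), ENNReal.ofReal (‖outFT f p‖ ^ 2 / (2 * p)) = 1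

/-- `∫_0^∞ dp/2p |f~(p)|² / (1 - e^{-2πp})`, with values in `[0, ∞]`. -/
def thermalIntegral (f : ℝ → ℂ) : ℝ≥0∞ :=
  ∫⁻ p in Ioi (0 : ℝ),
    ENNReal.ofReal (‖outFT f p‖ ^ 2 / (2 * p * (1 - Real.exp (-(2 * Real.pi * p)))))

/-! ### The outgoing field as an operator in the incoming Fock space

In terms of incoming modes, `[a(k), a†(k')] = 2k δ(k - k')`, the field is
`φ(x) = (2π)^{-1/2} ∫_0^∞ dk/2k (a(k) e^{-ikx} + b†(k) e^{ikx})`, with `b = a` for the real field and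
`b` an independent (antiparticle) species for the complex one.  The outgoing field is `φ(x(y))`;
smeared with `f` it is `∫_0^∞ dk/2k (a(k) (U f~)(k) + b†(k) (U f~)(-k))`.

We keep finitely many modes: the wave packets `e_j = w_j^{-1/2} 1_{I_j}`, orthonormal in
`L²(dk/2k, ℝ₊)`, on the momentum cells `I_j = ((j+1)/m, (j+2)/m]`, `j < mΛ`.  The regularization is
removed by `m, Λ → ∞`. -/

/-- Real or complex scalar field. -/
inductive FieldKind
  | real
  | complex

/-- Number of antiparticle species distinct from the particle. -/
def FieldKind.extra : FieldKind → ℕ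
  | real => 0
  | complex => 1

/-- Modes: a momentum cell and a species.  Species `0` is the particle, the last species is the
antiparticle (the particle itself for a real field). -/
abbrev Mode (s : FieldKind) (m Λ : ℕ) : Type := Fin (m * Λ) × Fin (s.extra + 1)

/-- The momentum cell `I_j`. -/
def cell (m : ℕ) (j : ℕ) : Set ℝ := Ioc (((j : ℝ) + 1) / m) (((j : ℝ) + 2) / m)

/-- The frequency assigned to the cell `I_j`: its upper end. -/
def cellFrequency (m : ℕ) (j : ℕ) : ℝ := ((j : ℝ) + 2) / m

/-- `⟨e_j, h⟩` in `L²(dk/2k, ℝ₊)`. -/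
def cellCoeff (m : ℕ) (j : ℕ) (h : ℝ → ℂ) : ℂ :=
  ((Real.sqrt (∫ k in cell m j, 1 / (2 * k)))⁻¹ : ℝ) * ∫ k in cell m j, h k / (2 * k)

/-- The regularized outgoing field smeared with `f`. -/
def field (s : FieldKind) (m Λ : ℕ) (f : ℝ → ℂ) :
    Fock (Mode s m Λ) →ₗ[ℂ] Fock (Mode s m Λ) :=
  ∑ j : Fin (m * Λ),
    (cellCoeff m j (fun k => inFT f k) • annihilation (κ := Mode s m Λ) (j, 0) +
      cellCoeff m j (fun k => inFT f (-k)) • creation (κ := Mode s m Λ) (j, Fin.last _))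

/-- The adjoint of `field s m Λ f`. -/
def fieldAdjoint (s : FieldKind) (m Λ : ℕ) (f : ℝ → ℂ) :
    Fock (Mode s m Λ) →ₗ[ℂ] Fock (Mode s m Λ) :=
  ∑ j : Fin (m * Λ),
    (star (cellCoeff m j (fun k => inFT f k)) • creation (κ := Mode s m Λ) (j, 0) +
      star (cellCoeff m j (fun k => inFT f (-k))) •
        annihilation (κ := Mode s m Λ) (j, Fin.last _))

/-- The regularized number observable, the product of the adjoint field and the field. -/
def numberOp (s : FieldKind) (m Λ : ℕ) (f : ℝ → ℂ) :
    Fock (Mode s m Λ) →ₗ[ℂ] Fock (Mode s m Λ) :=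
  fieldAdjoint s m Λ f ∘ₗ field s m Λ f

/-- `N` is the mean number, in the incoming vacuum, of spontaneously created particles with test
function `f`. -/
def IsSpontaneousNumber (s : FieldKind) (f : ℝ → ℂ) (N : ℝ≥0∞) : Prop :=
  Tendsto (fun r : ℕ × ℕ => ENNReal.ofReal (vacuumMean (numberOp s r.1 r.2 f)).re) atTop (𝓝 N)

/-- `N` is the mean number of created particles with test function `f`, in the incoming thermal
state of inverse temperature `β`. -/
def IsThermalNumber (s : FieldKind) (β : ℝ) (f : ℝ → ℂ) (N : ℝ≥0∞) : Prop :=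
  Tendsto (fun r : ℕ × ℕ => ENNReal.ofReal
    (gibbsMean β (fun i : Mode s r.1 r.2 => cellFrequency r.1 i.1)
      (numberOp s r.1 r.2 f)).re) atTop (𝓝 N)

end CGHS

end

namespace CGHS

/-! ### Means of the number observable in Fock space -/

section FockSpace

/-! Write `g = shift f yo` and `n_B(k) = 1/(e^{βk} - 1)`. In an occupation-number state only the
products `a†a` and `aa†` of one mode have a diagonal element, so the vacuum mean is a cell sum of
`|Ug~(-k)|²`. The Gibbs mean adds the same sums of `|Ug~(k)|²` and `|Ug~(-k)|²` weighted by `n_B`.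
These sums converge in `[0, ∞]` to integrals over `dk/2k` (`tendsto_cellSum`). Hence thermal number
= spontaneous number + stimulated number, and it remains to bound the stimulated one.

Stimulated part. Since `n_B(k) ≤ 1/(βk)`, it is at most `(1/2β) ∫ |Ug~(k)|²/k² dk` over the whole
line (`lintegral_bose_le`). The support condition forces `∫ g = 0`, so `Ug~(k)/(ik)` is the Fourier
transform of the primitive of `g` read in the coordinate `x`. Plancherel and `x'(y) = 1/(1 + e^y)`
give the bound `∫ |F(t)|²/(1 + e^{t+yo}) dt`, with `F` the primitive of `f`
(`lintegral_enorm_inFT_div_sq_le`). This integral is cut at `t = -(yo/2 + L)`. To the left, the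
decay of `f` gives `|F(t)| ≤ (C/α)|t|^{-α}`, which is square integrable because `α > 1/2`. To the
right, the weight is at most `e^{L - yo/2}`, and `∫ |F|² ≤ ∫ |f~|²/p² dp ≤ 4π I`
(`lintegral_primitive_le`, `primitiveNorm_le_thermalIntegral`).

Spontaneous part. It is finite when `I` is, by a Mellin transform
(`lintegral_enorm_inFT_neg_le_primitiveNorm`). Testing `g` against `exp(-i e^s e^{-x(y)})` and
transforming in `s` yields `Ug~` times a Gamma factor that is large enough on negative momenta.
Because `e^{-x} = 1 + e^{-y}`, the tested function is, up to a phase, the convolution of `g` with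
`exp(-i e^s)`, whose transform is at most `1/p` on positive momenta.

The kernels involved are not integrable. They are damped, Plancherel is applied to the damped
versions, and Fatou's lemma passes to the limit; only inequalities are needed. -/

open scoped Classical in
theorem ket_apply {κ : Type} (n m : κ → ℕ) : (ket n : Fock κ) m = if n = m then 1 else 0 := by
  simp [ket, Finsupp.single_apply]

variable {κ : Type} [DecidableEq κ]

theorem annihilation_ket (i : κ) (n : κ → ℕ) :
    annihilation i (ket n) = ((Real.sqrt (n i) : ℝ) : ℂ) • ket (n - Pi.single i 1) := by
  simp [annihilation, ket]

theorem creation_ket (i : κ) (n : κ → ℕ) :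
    creation i (ket n) = ((Real.sqrt (n i + 1) : ℝ) : ℂ) • ket (n + Pi.single i 1) := by
  simp [creation, ket]

theorem creation_annihilation_diag (i j : κ) (n : κ → ℕ) :
    (creation i (annihilation j (ket n)) : Fock κ) n = if i = j then (n i : ℂ) else 0 := by
  rw [annihilation_ket, map_smul, creation_ket, Finsupp.smul_apply, Finsupp.smul_apply, ket_apply]
  -- If `n j = 0`, truncated subtraction leaves `n` unchanged; the coefficient `√0` is what kills
  -- the term.
  rcases Nat.eq_zero_or_pos (n j) with h0 | h0
  · split_ifs with h1 h2 <;> simp_all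
  · by_cases hij : i = j
    · subst hij
      have h1 : n - Pi.single i 1 + Pi.single i 1 = n := by
        funext k
        by_cases hk : k = i
        · subst hk; simp; omega
        · simp [hk]
      have h2 : (((n - Pi.single i 1 : κ → ℕ) i : ℕ) : ℝ) + 1 = n i := by
        simp only [Pi.sub_apply, Pi.single_eq_same]
        rw [Nat.cast_sub h0]; simp
      rw [if_pos h1, h2, if_pos rfl, smul_eq_mul, smul_eq_mul, mul_one, ← Complex.ofReal_mul,
        Real.mul_self_sqrt (by positivity)]
      simp
    · have h1 : ¬ (n - Pi.single j 1 + Pi.single i 1 = n) := by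
        intro h
        have := congrFun h j
        simp [Ne.symm hij] at this
        omega
      simp [h1, hij]

theorem annihilation_creation_diag (i j : κ) (n : κ → ℕ) :
    (annihilation i (creation j (ket n)) : Fock κ) n = if i = j then (n i : ℂ) + 1 else 0 := by
  rw [creation_ket, map_smul, annihilation_ket, Finsupp.smul_apply, Finsupp.smul_apply, ket_apply]
  by_cases hij : i = j
  · subst hij
    have h1 : n + Pi.single i 1 - Pi.single i 1 = n := by
      funext k
      simp
    rw [if_pos h1, if_pos rfl]
    simp only [Pi.add_apply, Pi.single_eq_same, Nat.cast_add, Nat.cast_one, smul_eq_mul, mul_one]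
    rw [← Complex.ofReal_mul, Real.mul_self_sqrt (by positivity)]
    simp
  · have h1 : ¬ (n + Pi.single j 1 - Pi.single i 1 = n) := by
      intro h
      have := congrFun h j
      simp [Ne.symm hij] at this
    simp [h1, hij]

theorem creation_creation_diag (i j : κ) (n : κ → ℕ) :
    (creation i (creation j (ket n)) : Fock κ) n = 0 := by
  rw [creation_ket, map_smul, creation_ket, Finsupp.smul_apply, Finsupp.smul_apply, ket_apply]
  have h1 : ¬ (n + Pi.single j 1 + Pi.single i 1 = n) := by
    intro h
    have := congrFun h j
    simp only [Pi.add_apply, Pi.single_eq_same] at this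
    omega
  simp [h1]

theorem annihilation_annihilation_diag (i j : κ) (n : κ → ℕ) :
    (annihilation i (annihilation j (ket n)) : Fock κ) n = 0 := by
  rw [annihilation_ket, map_smul, annihilation_ket, Finsupp.smul_apply, Finsupp.smul_apply,
    ket_apply]
  rcases Nat.eq_zero_or_pos (n j) with h0 | h0
  · simp [h0]
  · have h1 : ¬ (n - Pi.single j 1 - Pi.single i 1 = n) := by
      intro h
      have := congrFun h j
      simp at this
      omega
    simp [h1]

end FockSpace

/-- Only pairs that restore every occupation number survive on the diagonal. For the real field the
two species coincide and the products `aa` and `a†a†` act within one species, but they still change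
the total number by two. The same formula therefore serves both kinds of field. -/
theorem numberOp_diag (s : FieldKind) (m Λ : ℕ) (f : ℝ → ℂ) (n : Mode s m Λ → ℕ) :
    (numberOp s m Λ f (ket n) : Fock (Mode s m Λ)) n =
      ((∑ j : Fin (m * Λ),
        (‖cellCoeff m j (fun k => inFT f k)‖ ^ 2 * (n (j, 0) : ℝ) +
          ‖cellCoeff m j (fun k => inFT f (-k))‖ ^ 2 * ((n (j, Fin.last _) : ℝ) + 1)) : ℝ) : ℂ) := by
  have key : ∀ z : ℂ, star z * z = ((‖z‖ ^ 2 : ℝ) : ℂ) := by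
    intro z
    rw [Complex.star_def, Complex.conj_mul']
    push_cast; rfl
  simp only [numberOp, fieldAdjoint, field, LinearMap.comp_apply, LinearMap.sum_apply,
    LinearMap.add_apply, LinearMap.smul_apply, map_sum, map_add, map_smul, Finsupp.finsetSum_apply,
    Finsupp.add_apply, Finsupp.smul_apply, creation_annihilation_diag, annihilation_creation_diag,
    creation_creation_diag, annihilation_annihilation_diag, Prod.mk.injEq, and_true, smul_eq_mul,
    mul_zero, mul_ite, Finset.sum_add_distrib]
  simp only [Finset.sum_const_zero, zero_add, add_zero, Finset.sum_ite_eq', Finset.mem_univ,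
    if_true]
  push_cast
  congr 1 <;> refine Finset.sum_congr rfl fun j _ => ?_
  · rw [← mul_assoc, mul_comm (cellCoeff _ _ _), key]
    push_cast; rfl
  · rw [← mul_assoc, mul_comm (cellCoeff _ _ _), key]
    push_cast; rfl

theorem vacuumMean_numberOp (s : FieldKind) (m Λ : ℕ) (f : ℝ → ℂ) :
    (vacuumMean (numberOp s m Λ f)).re =
      ∑ j : Fin (m * Λ), ‖cellCoeff m j (fun k => inFT f (-k))‖ ^ 2 := by
  rw [vacuumMean, numberOp_diag, Complex.ofReal_re]
  simp

/-! ### Gibbs weights and mean occupation numbers. -/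

section Gibbs

variable {κ : Type} [Fintype κ]

/-- Every finite set of multi-indices lies in a box, and over a box the sum of products is the
product of the sums. -/
theorem summable_prod_pi {a : κ → ℕ → ℝ} (h0 : ∀ i k, 0 ≤ a i k) (ha : ∀ i, Summable (a i)) :
    Summable fun n : κ → ℕ => ∏ i, a i (n i) := by
  classical
  refine summable_of_sum_le (c := ∏ i, ∑' k, a i k)
    (fun n => Finset.prod_nonneg fun i _ => h0 i _) fun u => ?_
  calc ∑ n ∈ u, ∏ i, a i (n i)
      ≤ ∑ n ∈ Fintype.piFinset fun i => u.image fun n => n i, ∏ i, a i (n i) := by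
        refine Finset.sum_le_sum_of_subset_of_nonneg (fun n hn => ?_)
          fun n _ _ => Finset.prod_nonneg fun i _ => h0 i _
        exact Fintype.mem_piFinset.2 fun i => Finset.mem_image_of_mem _ hn
    _ = ∏ i, ∑ k ∈ u.image fun n => n i, a i k := (Finset.prod_univ_sum _ _).symm
    _ ≤ ∏ i, ∑' k, a i k :=
        Finset.prod_le_prod (fun i _ => Finset.sum_nonneg fun k _ => h0 i k)
          fun i _ => (ha i).sum_le_tsum _ fun k _ => h0 i k

theorem exp_energy (β : ℝ) (ω : κ → ℝ) (n : κ → ℕ) :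
    Real.exp (-(β * energy ω n)) = ∏ i, Real.exp (-(β * ω i)) ^ n i := by
  simp only [← Real.exp_nat_mul, ← Real.exp_sum, energy, Finset.mul_sum, ← Finset.sum_neg_distrib]
  congr 1
  exact Finset.sum_congr rfl fun i _ => by ring

variable {β : ℝ} {ω : κ → ℝ}

/-- The factor `∏ (n i + 1)` dominates both `1` and each `n i` while keeping the product form, so
one summability covers the partition function and all mean occupations. -/
theorem summable_exp_energy_mul (hβ : 0 < β) (hω : ∀ i, 0 < ω i) :
    Summable fun n : κ → ℕ => (∏ i, ((n i : ℝ) + 1)) * Real.exp (-(β * energy ω n)) := by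
  have hr : ∀ i, ‖Real.exp (-(β * ω i))‖ < 1 := fun i => by
    rw [Real.norm_eq_abs, abs_of_pos (Real.exp_pos _), Real.exp_lt_one_iff]
    have := mul_pos hβ (hω i)
    linarith
  have := summable_prod_pi (κ := κ) (a := fun i k => ((k : ℝ) + 1) * Real.exp (-(β * ω i)) ^ k)
    (fun i k => by positivity) fun i => by
      simp only [add_mul, one_mul]
      refine Summable.add ?_ (summable_geometric_of_norm_lt_one (hr i))
      simpa using summable_pow_mul_geometric_of_norm_lt_one 1 (hr i)
  refine this.congr fun n => ?_
  rw [exp_energy, Finset.prod_mul_distrib]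

theorem summable_exp_energy (hβ : 0 < β) (hω : ∀ i, 0 < ω i) :
    Summable fun n : κ → ℕ => Real.exp (-(β * energy ω n)) := by
  refine (summable_exp_energy_mul hβ hω).of_nonneg_of_le (fun n => (Real.exp_pos _).le) fun n => ?_
  refine le_mul_of_one_le_left (Real.exp_pos _).le ?_
  exact Finset.one_le_prod fun i _ => by linarith [(Nat.cast_nonneg (n i) : (0 : ℝ) ≤ n i)]

theorem summable_occupation (hβ : 0 < β) (hω : ∀ i, 0 < ω i) (i : κ) :
    Summable fun n : κ → ℕ => Real.exp (-(β * energy ω n)) * n i := by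
  classical
  refine (summable_exp_energy_mul hβ hω).of_nonneg_of_le (fun n => by positivity) fun n => ?_
  rw [mul_comm]
  refine mul_le_mul_of_nonneg_right ?_ (Real.exp_pos _).le
  rw [← Finset.mul_prod_erase _ _ (Finset.mem_univ i)]
  have h1 : 1 ≤ ∏ j ∈ Finset.univ.erase i, ((n j : ℝ) + 1) :=
    Finset.one_le_prod fun j _ => by linarith [(Nat.cast_nonneg (n j) : (0 : ℝ) ≤ n j)]
  nlinarith [(Nat.cast_nonneg (n i) : (0 : ℝ) ≤ n i)]

/-- The Bose distribution. -/
theorem tsum_occupation (hβ : 0 < β) (hω : ∀ i, 0 < ω i) (i : κ) :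
    ∑' n : κ → ℕ, Real.exp (-(β * energy ω n)) * n i =
      (∑' n : κ → ℕ, Real.exp (-(β * energy ω n))) * (1 / (Real.exp (β * ω i) - 1)) := by
  classical
  set S := ∑' n : κ → ℕ, Real.exp (-(β * energy ω n)) * n i
  set Z := ∑' n : κ → ℕ, Real.exp (-(β * energy ω n))
  -- States with `n i = 0` contribute nothing to `S`, and the others are the `n + e_i`. Reindexing
  -- costs one Boltzmann factor and turns `n i` into `n i + 1`; the resulting linear equation
  -- determines `S`.
  have hshift : S = Real.exp (-(β * ω i)) * (S + Z) := by
    have hinj : Function.Injective fun n : κ → ℕ => n + Pi.single i 1 := add_left_injective _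
    have hsupp : Function.support (fun n : κ → ℕ => Real.exp (-(β * energy ω n)) * n i) ⊆
        Set.range fun n : κ → ℕ => n + Pi.single i 1 := by
      intro n hn
      have hni : n i ≠ 0 := by
        intro h
        simp [h] at hn
      refine ⟨n - Pi.single i 1, ?_⟩
      funext k
      by_cases hk : k = i
      · subst hk; simp; omega
      · simp [hk]
    calc S = ∑' n : κ → ℕ, Real.exp (-(β * energy ω (n + Pi.single i 1))) *
          ((n + Pi.single i 1 : κ → ℕ) i : ℕ) := (hinj.tsum_eq hsupp).symm
      _ = ∑' n : κ → ℕ, Real.exp (-(β * ω i)) *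
          (Real.exp (-(β * energy ω n)) * n i + Real.exp (-(β * energy ω n))) := by
        refine tsum_congr fun n => ?_
        have : energy ω (n + Pi.single i 1) = energy ω n + ω i := by
          simp [energy, add_mul, Finset.sum_add_distrib, Pi.single_apply]
        rw [this, show -(β * (energy ω n + ω i)) = -(β * ω i) + -(β * energy ω n) by ring,
          Real.exp_add]
        simp
        ring
      _ = _ := by
        rw [tsum_mul_left, (summable_occupation hβ hω i).tsum_add (summable_exp_energy hβ hω)]
  have hlt : 1 < Real.exp (β * ω i) := Real.one_lt_exp_iff.2 (mul_pos hβ (hω i))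
  rw [Real.exp_neg] at hshift
  have hpos := Real.exp_pos (β * ω i)
  field_simp at hshift
  rw [mul_one_div, eq_div_iff (by linarith)]
  linarith

theorem tsum_exp_energy_pos (hβ : 0 < β) (hω : ∀ i, 0 < ω i) :
    0 < ∑' n : κ → ℕ, Real.exp (-(β * energy ω n)) :=
  (summable_exp_energy hβ hω).tsum_pos (fun _ => (Real.exp_pos _).le) 0 (Real.exp_pos _)

end Gibbs

theorem gibbsMean_numberOp (s : FieldKind) (m Λ : ℕ) (f : ℝ → ℂ) {β : ℝ} (hβ : 0 < β) :
    (gibbsMean β (fun i : Mode s m Λ => cellFrequency m i.1) (numberOp s m Λ f)).re =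
      ∑ j : Fin (m * Λ),
        (‖cellCoeff m j (fun k => inFT f k)‖ ^ 2 * (1 / (Real.exp (β * cellFrequency m j) - 1)) +
          ‖cellCoeff m j (fun k => inFT f (-k))‖ ^ 2 *
            (1 / (Real.exp (β * cellFrequency m j) - 1) + 1)) := by
  set ω : Mode s m Λ → ℝ := fun i => cellFrequency m i.1 with hω_def
  have hω : ∀ i, 0 < ω i := by
    rintro ⟨j, i⟩
    -- An index in `Fin (m * Λ)` excludes `m = 0`, where the frequency would be the default value
    -- `0`.
    have hm : 0 < m := by
      rcases Nat.eq_zero_or_pos m with h | h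
      · exact absurd j.2 (by simp [h])
      · exact h
    simp only [hω_def, cellFrequency]
    positivity
  have hZ := tsum_exp_energy_pos hβ hω
  set Z := ∑' n : Mode s m Λ → ℕ, Real.exp (-(β * energy ω n)) with hZ_def
  rw [gibbsMean]
  simp only [numberOp_diag, ← Complex.ofReal_mul]
  rw [← Complex.ofReal_tsum, ← Complex.ofReal_tsum, ← Complex.ofReal_div, Complex.ofReal_re,
    ← hZ_def, div_eq_iff hZ.ne', Finset.sum_mul]
  simp only [Finset.mul_sum]
  rw [Summable.tsum_finsetSum]
  · refine Finset.sum_congr rfl fun j _ => ?_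
    have e : ∀ n : Mode s m Λ → ℕ, Real.exp (-(β * energy ω n)) *
        (‖cellCoeff m j (fun k => inFT f k)‖ ^ 2 * (n (j, 0) : ℝ) +
          ‖cellCoeff m j (fun k => inFT f (-k))‖ ^ 2 * ((n (j, Fin.last _) : ℝ) + 1)) =
        ‖cellCoeff m j (fun k => inFT f k)‖ ^ 2 * (Real.exp (-(β * energy ω n)) * n (j, 0)) +
        ‖cellCoeff m j (fun k => inFT f (-k))‖ ^ 2 *
          (Real.exp (-(β * energy ω n)) * n (j, Fin.last _) + Real.exp (-(β * energy ω n))) :=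
      fun n => by ring
    have s1 := summable_occupation hβ hω (j, 0)
    have s2 := summable_occupation hβ hω (j, Fin.last _)
    have s3 := summable_exp_energy hβ hω
    simp only [e]
    rw [(s1.mul_left _).tsum_add ((s2.add s3).mul_left _), tsum_mul_left, tsum_mul_left,
      s2.tsum_add s3, tsum_occupation hβ hω, tsum_occupation hβ hω]
    simp only [hω_def]
    ring
  · intro j _
    have s1 := summable_occupation hβ hω (j, 0)
    have s2 := summable_occupation hβ hω (j, Fin.last _)
    have s3 := summable_exp_energy hβ hω
    refine ((s1.mul_left (‖cellCoeff m j (fun k => inFT f k)‖ ^ 2)).add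
      ((s2.add s3).mul_left (‖cellCoeff m j (fun k => inFT f (-k))‖ ^ 2))).congr fun n => ?_
    ring

/-! ### Removal of the regularization -/

section Cells

variable {m j : ℕ}

theorem cell_lower_pos (hm : 0 < m) : (0 : ℝ) < ((j : ℝ) + 1) / m := by positivity

theorem cell_subset_Ioi : cell m j ⊆ Ioi 0 := fun k hk =>
  lt_of_le_of_lt (by positivity : (0 : ℝ) ≤ ((j : ℝ) + 1) / m) hk.1

theorem measurableSet_cell : MeasurableSet (cell m j) := measurableSet_Ioc

theorem pairwise_disjoint_cell (m : ℕ) : Pairwise (Function.onFun Disjoint (cell m)) := by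
  rw [pairwise_disjoint_on]
  intro i j hij
  refine Set.disjoint_left.2 fun k hi hj => ?_
  have h1 : ((i : ℝ) + 2) / m ≤ ((j : ℝ) + 1) / m := by
    have : (i : ℝ) + 1 ≤ j := by exact_mod_cast hij
    exact div_le_div_of_nonneg_right (by linarith) (Nat.cast_nonneg m)
  exact absurd (lt_of_lt_of_le hj.1 (hi.2.trans h1)) (lt_irrefl _)

theorem integrableOn_cell {E : Type*} [NormedAddCommGroup E] (hm : 0 < m) {g : ℝ → E}
    (hg : ContinuousOn g (Ioi 0)) : IntegrableOn g (cell m j) := by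
  have : IntegrableOn g (Icc (((j : ℝ) + 1) / m) (((j : ℝ) + 2) / m)) :=
    (hg.mono fun k hk => lt_of_lt_of_le (cell_lower_pos hm) hk.1).integrableOn_Icc
  exact this.mono_set Ioc_subset_Icc_self

theorem continuousOn_inv_two_mul : ContinuousOn (fun k : ℝ => 1 / (2 * k)) (Ioi 0) :=
  continuousOn_const.div (by fun_prop) fun k hk => by
    have : (0 : ℝ) < k := hk
    positivity

/-- The measure of a cell with respect to `dk/2k`. -/
theorem cell_weight_pos (hm : 0 < m) : 0 < ∫ k in cell m j, 1 / (2 * k) := by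
  rw [setIntegral_pos_iff_support_of_nonneg_ae]
  · have : Function.support (fun k : ℝ => 1 / (2 * k)) ∩ cell m j = cell m j := by
      refine inter_eq_right.2 fun k hk => ?_
      have : (0 : ℝ) < k := cell_subset_Ioi hk
      exact (by positivity : 1 / (2 * k) ≠ 0)
    rw [this, cell, Real.volume_Ioc]
    have : (0 : ℝ) < m := by exact_mod_cast hm
    simp only [ENNReal.ofReal_pos, sub_pos]
    gcongr
    linarith
  · refine (ae_restrict_iff' measurableSet_cell).2 (ae_of_all _ fun k hk => ?_)
    have : (0 : ℝ) < k := cell_subset_Ioi hk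
    exact (by positivity : 0 ≤ 1 / (2 * k))
  · exact integrableOn_cell hm continuousOn_inv_two_mul

theorem norm_cellCoeff_sq (h : ℝ → ℂ) : ‖cellCoeff m j h‖ ^ 2 =
    ‖∫ k in cell m j, h k / (2 * k)‖ ^ 2 / ∫ k in cell m j, 1 / (2 * k) := by
  have : 0 ≤ ∫ k in cell m j, 1 / (2 * k) := setIntegral_nonneg measurableSet_cell fun k hk => by
    have : (0 : ℝ) < k := cell_subset_Ioi hk
    positivity
  rw [cellCoeff, norm_mul, mul_pow, Complex.norm_real, Real.norm_eq_abs, sq_abs, inv_pow,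
    Real.sq_sqrt this]
  ring

theorem norm_cellCoeff_sq_le (hm : 0 < m) {h : ℝ → ℂ} (hc : Continuous h) :
    ‖cellCoeff m j h‖ ^ 2 ≤ ∫ k in cell m j, ‖h k‖ ^ 2 / (2 * k) := by
  have hw := cell_weight_pos (j := j) hm
  set w := ∫ k in cell m j, 1 / (2 * k)
  set A := ∫ k in cell m j, ‖h k‖ / (2 * k) with hA
  have hne : ∀ k ∈ Ioi (0 : ℝ), 2 * k ≠ 0 := fun k hk => by
    have : (0 : ℝ) < k := hk
    positivity
  have i1 : IntegrableOn (fun k : ℝ => 1 / (2 * k)) (cell m j) :=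
    integrableOn_cell hm continuousOn_inv_two_mul
  have i2 : IntegrableOn (fun k : ℝ => ‖h k‖ / (2 * k)) (cell m j) :=
    integrableOn_cell hm (hc.norm.continuousOn.div (by fun_prop) hne)
  have i3 : IntegrableOn (fun k : ℝ => ‖h k‖ ^ 2 / (2 * k)) (cell m j) :=
    integrableOn_cell hm ((hc.norm.pow 2).continuousOn.div (by fun_prop) hne)
  have hle : ‖∫ k in cell m j, h k / (2 * k)‖ ≤ A := by
    refine (norm_integral_le_integral_norm _).trans (le_of_eq ?_)
    refine setIntegral_congr_fun measurableSet_cell fun k hk => ?_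
    have : (0 : ℝ) < k := cell_subset_Ioi hk
    simp [abs_of_pos this]
  -- Cauchy–Schwarz in variance form: `A / w` is the mean of `‖h‖` on the cell.
  have hsq : 0 ≤ ∫ k in cell m j, (‖h k‖ - A / w) ^ 2 / (2 * k) :=
    setIntegral_nonneg measurableSet_cell fun k hk => by
      have : (0 : ℝ) < k := cell_subset_Ioi hk
      positivity
  have hexp : ∫ k in cell m j, (‖h k‖ - A / w) ^ 2 / (2 * k) =
      (∫ k in cell m j, ‖h k‖ ^ 2 / (2 * k)) - 2 * (A / w) * A + (A / w) ^ 2 * w := by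
    have e : ∀ k : ℝ, (‖h k‖ - A / w) ^ 2 / (2 * k) =
        ‖h k‖ ^ 2 / (2 * k) - 2 * (A / w) * (‖h k‖ / (2 * k)) + (A / w) ^ 2 * (1 / (2 * k)) :=
      fun k => by ring
    have i4 : IntegrableOn
        (fun k => ‖h k‖ ^ 2 / (2 * k) - 2 * (A / w) * (‖h k‖ / (2 * k))) (cell m j) :=
      i3.sub (i2.const_mul _)
    simp only [e]
    rw [integral_add i4 (i1.const_mul _), integral_sub i3 (i2.const_mul _), integral_const_mul, integral_const_mul]
  rw [norm_cellCoeff_sq, div_le_iff₀ hw]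
  have h2 : ‖∫ k in cell m j, h k / (2 * k)‖ ^ 2 ≤ A ^ 2 := by gcongr
  rw [hexp] at hsq
  have h3 : 2 * (A / w) * A - (A / w) ^ 2 * w = A ^ 2 / w := by field_simp; ring
  have h4 : A ^ 2 / w ≤ ∫ k in cell m j, ‖h k‖ ^ 2 / (2 * k) := by linarith
  exact h2.trans ((div_le_iff₀ hw).1 h4)

/-- The constant `z` is its own mean for the weight `dk/2k`, so the difference is the mean of `h -
z`. -/
theorem norm_cellAverage_sub_le (hm : 0 < m) {h : ℝ → ℂ} (hc : Continuous h) (z : ℂ) {ε : ℝ}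
    (hε : ∀ k ∈ cell m j, ‖h k - z‖ ≤ ε) :
    ‖(∫ k in cell m j, h k / (2 * k)) / ((∫ k in cell m j, 1 / (2 * k) : ℝ) : ℂ) - z‖ ≤ ε := by
  have hw := cell_weight_pos (j := j) hm
  set w := ∫ k in cell m j, 1 / (2 * k) with hw_def
  have hne : ∀ k ∈ Ioi (0 : ℝ), (2 * (k : ℂ)) ≠ 0 := fun k hk => by
    have : (0 : ℝ) < k := hk
    exact_mod_cast (by positivity : (2 * k) ≠ 0)
  have i1 : IntegrableOn (fun k : ℝ => 1 / (2 * k)) (cell m j) :=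
    integrableOn_cell hm continuousOn_inv_two_mul
  have i2 : IntegrableOn (fun k : ℝ => h k / (2 * k)) (cell m j) :=
    integrableOn_cell hm (hc.continuousOn.div (by fun_prop) hne)
  have i3 : IntegrableOn (fun k : ℝ => z * ((1 / (2 * k) : ℝ) : ℂ)) (cell m j) :=
    (i1.ofReal (𝕜 := ℂ)).const_mul z
  have hz : z * (w : ℂ) = ∫ k in cell m j, z * ((1 / (2 * k) : ℝ) : ℂ) := by
    rw [integral_const_mul, integral_complex_ofReal]
  have hwc : (w : ℂ) ≠ 0 := by exact_mod_cast hw.ne'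
  have e : (∫ k in cell m j, h k / (2 * k)) / (w : ℂ) - z =
      (∫ k in cell m j, (h k / (2 * k) - z * ((1 / (2 * k) : ℝ) : ℂ))) / (w : ℂ) := by
    rw [integral_sub i2 i3, ← hz, sub_div, mul_div_cancel_right₀ _ hwc]
  rw [e, norm_div, Complex.norm_real, Real.norm_eq_abs, abs_of_pos hw, div_le_iff₀ hw, hw_def,
    ← integral_const_mul]
  refine norm_integral_le_of_norm_le (i1.const_mul ε) ?_
  refine (ae_restrict_iff' measurableSet_cell).2 (ae_of_all _ fun k hk => ?_)
  have hk0 : (0 : ℝ) < k := cell_subset_Ioi hk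
  have : h k / (2 * k) - z * ((1 / (2 * k) : ℝ) : ℂ) = (h k - z) * ((1 / (2 * k) : ℝ) : ℂ) := by
    push_cast; ring
  rw [this, norm_mul, Complex.norm_real, Real.norm_eq_abs, abs_of_pos (by positivity)]
  exact mul_le_mul_of_nonneg_right (hε k hk) (by positivity)

end Cells

/-! ### Convergence of the cell sums to the momentum integral. -/

section Limit

variable {h : ℝ → ℂ} {q : ℝ → ℝ}

/-- Cauchy–Schwarz on each cell, then `q (cellFrequency m j) ≤ q k`. The second step holds because
the assigned frequency is the upper end of the cell and `q` decreases; it gives the upper bound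
without error terms. -/
theorem cellSum_le (hc : Continuous h) (hq0 : ∀ k, 0 < k → 0 ≤ q k)
    (hqa : AntitoneOn q (Ioi 0)) {m : ℕ} (hm : 0 < m) (Λ : ℕ) :
    ENNReal.ofReal (∑ j : Fin (m * Λ), ‖cellCoeff m j h‖ ^ 2 * q (cellFrequency m j)) ≤
      ∫⁻ k in Ioi 0, ENNReal.ofReal (‖h k‖ ^ 2 * q k / (2 * k)) := by
  have hωpos : ∀ j : ℕ, 0 < cellFrequency m j := fun j => by
    unfold cellFrequency; positivity
  have hne : ∀ k ∈ Ioi (0 : ℝ), 2 * k ≠ 0 := fun k hk => by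
    have : (0 : ℝ) < k := hk
    positivity
  rw [ENNReal.ofReal_sum_of_nonneg fun j _ => mul_nonneg (sq_nonneg _) (hq0 _ (hωpos _))]
  have hdisj : Pairwise (Function.onFun Disjoint fun j : Fin (m * Λ) => cell m j) :=
    fun i j hij => pairwise_disjoint_cell m fun e => hij (Fin.ext e)
  calc ∑ j : Fin (m * Λ), ENNReal.ofReal (‖cellCoeff m j h‖ ^ 2 * q (cellFrequency m j))
      ≤ ∑ j : Fin (m * Λ), ∫⁻ k in cell m j, ENNReal.ofReal (‖h k‖ ^ 2 * q k / (2 * k)) := by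
        refine Finset.sum_le_sum fun j _ => ?_
        have i3 : IntegrableOn (fun k : ℝ => ‖h k‖ ^ 2 / (2 * k)) (cell m j) :=
          integrableOn_cell hm ((hc.norm.pow 2).continuousOn.div (by fun_prop) hne)
        calc ENNReal.ofReal (‖cellCoeff m j h‖ ^ 2 * q (cellFrequency m j))
            ≤ ENNReal.ofReal (∫ k in cell m j,
                ‖h k‖ ^ 2 / (2 * k) * q (cellFrequency m j)) := by
              rw [integral_mul_const]
              exact ENNReal.ofReal_le_ofReal (mul_le_mul_of_nonneg_right
                (norm_cellCoeff_sq_le hm hc) (hq0 _ (hωpos _)))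
          _ = ∫⁻ k in cell m j,
                ENNReal.ofReal (‖h k‖ ^ 2 / (2 * k) * q (cellFrequency m j)) := by
              refine ofReal_integral_eq_lintegral_ofReal (i3.mul_const _) ?_
              refine (ae_restrict_iff' measurableSet_cell).2 (ae_of_all _ fun k hk => ?_)
              have hk0 : (0 : ℝ) < k := cell_subset_Ioi hk
              exact mul_nonneg (by positivity) (hq0 _ (hωpos _))
          _ ≤ _ := by
              refine setLIntegral_mono' measurableSet_cell fun k hk => ?_
              have hk0 : (0 : ℝ) < k := cell_subset_Ioi hk
              refine ENNReal.ofReal_le_ofReal ?_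
              rw [div_mul_eq_mul_div]
              have := hqa hk0 (hωpos j) hk.2
              gcongr
    _ = ∫⁻ k in ⋃ j : Fin (m * Λ), cell m j, ENNReal.ofReal (‖h k‖ ^ 2 * q k / (2 * k)) := by
        rw [lintegral_iUnion (fun j => measurableSet_cell) hdisj, tsum_fintype]
    _ ≤ _ := lintegral_mono_set (iUnion_subset fun j => cell_subset_Ioi)

/-- The step function whose integral is the regularized mean. -/
noncomputable def cellStep (h : ℝ → ℂ) (q : ℝ → ℝ) (r : ℕ × ℕ) (k : ℝ) : ℝ≥0∞ :=
  ∑ j : Fin (r.1 * r.2), (cell r.1 j).indicator (fun k => ENNReal.ofReal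
    (‖cellCoeff r.1 j h‖ ^ 2 * q (cellFrequency r.1 j) / ∫ k in cell r.1 j, 1 / (2 * k)) *
      ENNReal.ofReal (1 / (2 * k))) k

theorem measurable_cellStep (r : ℕ × ℕ) : Measurable (cellStep h q r) := by
  unfold cellStep
  refine Finset.measurable_fun_sum _ fun j _ => Measurable.indicator ?_ measurableSet_cell
  fun_prop

theorem lintegral_cellStep (hq0 : ∀ k, 0 < k → 0 ≤ q k) {r : ℕ × ℕ} (hm : 0 < r.1) :
    ∫⁻ k in Ioi 0, cellStep h q r k = ENNReal.ofReal
      (∑ j : Fin (r.1 * r.2), ‖cellCoeff r.1 j h‖ ^ 2 * q (cellFrequency r.1 j)) := by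
  have hωpos : ∀ j : ℕ, 0 < cellFrequency r.1 j := fun j => by
    unfold cellFrequency; positivity
  rw [ENNReal.ofReal_sum_of_nonneg fun j _ => mul_nonneg (sq_nonneg _) (hq0 _ (hωpos _))]
  unfold cellStep
  rw [lintegral_finsetSum]
  · refine Finset.sum_congr rfl fun j _ => ?_
    have hw := cell_weight_pos (j := j) hm
    rw [lintegral_indicator measurableSet_cell, Measure.restrict_restrict measurableSet_cell,
      inter_eq_left.2 cell_subset_Ioi, lintegral_const_mul _ (by fun_prop),
      ← ofReal_integral_eq_lintegral_ofReal (integrableOn_cell hm continuousOn_inv_two_mul),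
      ← ENNReal.ofReal_mul (div_nonneg (mul_nonneg (sq_nonneg _) (hq0 _ (hωpos _))) hw.le),
      div_mul_cancel₀ _ hw.ne']
    refine (ae_restrict_iff' measurableSet_cell).2 (ae_of_all _ fun k hk => ?_)
    have hk0 : (0 : ℝ) < k := cell_subset_Ioi hk
    exact (by positivity : 0 ≤ 1 / (2 * k))
  · intro j _
    exact Measurable.indicator (by fun_prop) measurableSet_cell

theorem le_liminf_cellStep (hc : Continuous h) (hqc : ContinuousOn q (Ioi 0)) {k : ℝ}
    (hk : 0 < k) :
    ENNReal.ofReal (‖h k‖ ^ 2 * q k / (2 * k)) ≤ liminf (fun r => cellStep h q r k) atTop := by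
  -- The index of the cell containing `k`: `J + 1 < m k ≤ J + 2`. The subtraction is not truncated
  -- once `m k > 1`.
  set J : ℕ × ℕ → ℕ := fun r => ⌈(r.1 : ℝ) * k⌉₊ - 2 with hJ
  have hfst : Tendsto (fun r : ℕ × ℕ => (r.1 : ℝ)) atTop atTop :=
    tendsto_natCast_atTop_atTop.comp (prod_atTop_atTop_eq (α := ℕ) (β := ℕ) ▸ tendsto_fst)
  have hsnd : Tendsto (fun r : ℕ × ℕ => (r.2 : ℝ)) atTop atTop :=
    tendsto_natCast_atTop_atTop.comp (prod_atTop_atTop_eq (α := ℕ) (β := ℕ) ▸ tendsto_snd)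
  have hev : ∀ᶠ r : ℕ × ℕ in atTop, 0 < r.1 ∧ k ∈ cell r.1 (J r) ∧ J r < r.1 * r.2 := by
    filter_upwards [hfst.eventually_gt_atTop (1 / k), hfst.eventually_ge_atTop 1,
      hsnd.eventually_ge_atTop (k + 1)] with r h1 h2 h3
    have hm : (0 : ℝ) < r.1 := by linarith
    have h4 : 1 < (r.1 : ℝ) * k := by rwa [div_lt_iff₀ hk] at h1
    have h5 : 2 ≤ ⌈(r.1 : ℝ) * k⌉₊ := Nat.lt_ceil.2 (by simpa using h4)
    have h6 : ((J r : ℕ) : ℝ) = ⌈(r.1 : ℝ) * k⌉₊ - 2 := by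
      simp only [hJ]; rw [Nat.cast_sub h5]; norm_num
    have h7 := Nat.ceil_lt_add_one (by positivity : 0 ≤ (r.1 : ℝ) * k)
    have h8 := Nat.le_ceil ((r.1 : ℝ) * k)
    refine ⟨by exact_mod_cast hm, ⟨?_, ?_⟩, ?_⟩
    · rw [div_lt_iff₀ hm, h6]; linarith
    · rw [le_div_iff₀ hm, h6]; linarith
    · have : ((J r : ℕ) : ℝ) < r.1 * r.2 := by
        rw [h6]
        nlinarith
      exact_mod_cast this
  have hdist : ∀ δ > 0, ∀ᶠ r : ℕ × ℕ in atTop,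
      (∀ k' ∈ cell r.1 (J r), |k' - k| < δ) ∧ |cellFrequency r.1 (J r) - k| < δ := by
    intro δ hδ
    filter_upwards [hev, hfst.eventually_gt_atTop (1 / δ)] with r ⟨hm, hkc, _⟩ h1
    have hm : (0 : ℝ) < r.1 := by exact_mod_cast hm
    have h2 : 1 / (r.1 : ℝ) < δ := by
      rw [div_lt_iff₀ hδ] at h1; rw [div_lt_iff₀ hm]; linarith
    have h3 : ((J r : ℝ) + 2) / r.1 = ((J r : ℝ) + 1) / r.1 + 1 / r.1 := by ring
    have h4 := hkc.1
    have h5 := hkc.2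
    unfold cellFrequency
    refine ⟨fun k' hk' => ?_, ?_⟩
    · have h6 := hk'.1
      have h7 := hk'.2
      rw [abs_lt]; constructor <;> linarith
    · rw [abs_lt]; constructor <;> linarith
  have hω : Tendsto (fun r => cellFrequency r.1 (J r)) atTop (𝓝 k) := by
    rw [Metric.tendsto_nhds]
    intro δ hδ
    filter_upwards [hdist δ hδ] with r hr using hr.2
  have hq : Tendsto (fun r => q (cellFrequency r.1 (J r))) atTop (𝓝 (q k)) :=
    ((hqc.continuousAt (Ioi_mem_nhds hk)).tendsto).comp hω
  have havg : Tendsto (fun r : ℕ × ℕ => (∫ k in cell r.1 (J r), h k / (2 * k)) /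
      ((∫ k in cell r.1 (J r), 1 / (2 * k) : ℝ) : ℂ)) atTop (𝓝 (h k)) := by
    rw [Metric.tendsto_nhds]
    intro ε hε
    obtain ⟨δ, hδ, hδ'⟩ := Metric.continuous_iff.1 hc k (ε / 2) (by positivity)
    filter_upwards [hdist δ hδ, hev] with r hr hr'
    rw [dist_eq_norm]
    refine lt_of_le_of_lt (norm_cellAverage_sub_le hr'.1 hc (h k) (ε := ε / 2) ?_) (by linarith)
    intro k' hk'
    have := hδ' k' (by rw [Real.dist_eq]; exact hr.1 k' hk')
    rw [dist_eq_norm] at this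
    exact this.le
  have hlim := ENNReal.tendsto_ofReal
    ((((havg.norm.pow 2).mul hq).mul_const (1 / (2 * k))))
  rw [mul_one_div] at hlim
  rw [← hlim.liminf_eq]
  refine liminf_le_liminf ?_
  filter_upwards [hev] with r ⟨hm, hkc, hJr⟩
  unfold cellStep
  -- The single term of the cell around `k` suffices as a lower bound; it is the squared mean of `h`
  -- on that cell times the sampled `q / (2k)`.
  refine le_trans (le_of_eq ?_) (Finset.single_le_sum (fun _ _ => zero_le)
    (Finset.mem_univ (⟨J r, hJr⟩ : Fin (r.1 * r.2))))
  have hw := cell_weight_pos (j := J r) hm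
  rw [indicator_of_mem hkc, ← ENNReal.ofReal_mul' (by positivity), norm_cellCoeff_sq, norm_div,
    Complex.norm_real, Real.norm_eq_abs, abs_of_pos hw]
  congr 1
  simp only
  field_simp

/-- The lower bound is Fatou's lemma for the step functions, the upper bound is `cellSum_le`. No
integrability is assumed: the limit may be `∞`. -/
theorem tendsto_cellSum (hc : Continuous h) (hq0 : ∀ k, 0 < k → 0 ≤ q k)
    (hqa : AntitoneOn q (Ioi 0)) (hqc : ContinuousOn q (Ioi 0)) :
    Tendsto (fun r : ℕ × ℕ => ENNReal.ofReal
      (∑ j : Fin (r.1 * r.2), ‖cellCoeff r.1 j h‖ ^ 2 * q (cellFrequency r.1 j))) atTop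
      (𝓝 (∫⁻ k in Ioi 0, ENNReal.ofReal (‖h k‖ ^ 2 * q k / (2 * k)))) := by
  have hpos : ∀ᶠ r : ℕ × ℕ in atTop, 0 < r.1 := by
    filter_upwards [eventually_ge_atTop ((1, 0) : ℕ × ℕ)] with r hr using hr.1
  refine tendsto_of_le_liminf_of_limsup_le ?_ ?_
  · calc ∫⁻ k in Ioi 0, ENNReal.ofReal (‖h k‖ ^ 2 * q k / (2 * k))
        ≤ ∫⁻ k in Ioi 0, liminf (fun r => cellStep h q r k) atTop :=
          setLIntegral_mono' measurableSet_Ioi fun k hk => le_liminf_cellStep hc hqc hk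
      _ ≤ liminf (fun r => ∫⁻ k in Ioi 0, cellStep h q r k) atTop :=
          lintegral_liminf_le fun r => measurable_cellStep r
      _ = _ := liminf_congr (hpos.mono fun r hr => lintegral_cellStep hq0 hr)
  · exact limsup_le_of_le (by isBoundedDefault) (hpos.mono fun r hr => cellSum_le hc hq0 hqa hr _)

end Limit

/-! ### Plancherel for integrable functions -/

section Plancherel

open scoped FourierTransform SchwartzMap

theorem continuous_fourier_of_integrable {f : ℝ → ℂ} (hf : Integrable f) : Continuous (𝓕 f) :=
  VectorFourier.fourierIntegral_continuous Real.continuous_fourierChar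
    continuous_inner hf

theorem integral_fourier_mul_eq_flip {f g : ℝ → ℂ} (hf : Integrable f) (hg : Integrable g) :
    ∫ x, 𝓕 f x * g x = ∫ x, f x * 𝓕 g x := by
  have := VectorFourier.integral_fourierIntegral_smul_eq_flip (L := innerₗ ℝ) (μ := volume)
    (ν := volume) Real.continuous_fourierChar continuous_inner hf hg
  rw [flip_innerₗ] at this
  exact this

/-- Both transforms are locally integrable and agree when tested on smooth compactly supported
functions, since the Fourier transform can be moved onto the test function in either case. -/
theorem fourier_toLp_ae_eq {f : ℝ → ℂ} (hf : Integrable f) (hf2 : MemLp f 2) :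
    (𝓕 (hf2.toLp f) : Lp ℂ 2 (volume : Measure ℝ)) =ᵐ[volume] 𝓕 f := by
  refine ae_eq_of_integral_contDiff_smul_eq
    ((Lp.memLp _).locallyIntegrable (by norm_num))
    (continuous_fourier_of_integrable hf).locallyIntegrable fun g hg hgs => ?_
  have hgs' : HasCompactSupport (fun x => (g x : ℂ)) := hgs.comp_left (g := Complex.ofReal) rfl
  have hg' : ContDiff ℝ (⊤ : ℕ∞) (fun x => (g x : ℂ)) := Complex.ofRealCLM.contDiff.comp hg
  let φ : 𝓢(ℝ, ℂ) := hgs'.toSchwartzMap hg'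
  have hφ : ∀ x, φ x = (g x : ℂ) := fun x => rfl
  have h1 : ∫ x, φ x • (𝓕 (hf2.toLp f) : Lp ℂ 2 (volume : Measure ℝ)) x =
      ∫ x, (𝓕 φ) x • (hf2.toLp f) x := by
    rw [← Lp.toTemperedDistribution_apply, ← Lp.toTemperedDistribution_apply,
      ← Lp.fourier_toTemperedDistribution_eq, TemperedDistribution.fourier_apply]
  have h2 : ∫ x, (𝓕 φ) x • (hf2.toLp f) x = ∫ x, φ x * 𝓕 f x := by
    rw [← integral_fourier_mul_eq_flip φ.integrable hf]
    refine integral_congr_ae ?_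
    filter_upwards [hf2.coeFn_toLp] with x hx
    rw [hx, smul_eq_mul, SchwartzMap.fourier_coe]
  simp only [hφ, smul_eq_mul] at h1 h2
  simp only [Complex.real_smul]
  rw [h1, ← h2]

theorem lintegral_enorm_fourier_sq {f : ℝ → ℂ} (hf : Integrable f) (hf2 : MemLp f 2) :
    ∫⁻ ξ, ‖𝓕 f ξ‖ₑ ^ 2 = ∫⁻ x, ‖f x‖ₑ ^ 2 := by
  have key : ∀ u : ℝ → ℂ, (eLpNorm u 2 volume) ^ 2 = ∫⁻ x, ‖u x‖ₑ ^ 2 := fun u => by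
    rw [eLpNorm_eq_lintegral_rpow_enorm_toReal (by norm_num) (by norm_num)]
    rw [← ENNReal.rpow_natCast, ← ENNReal.rpow_mul]
    simp
  rw [← key, ← key, ← eLpNorm_congr_ae (fourier_toLp_ae_eq hf hf2),
    ← eLpNorm_congr_ae hf2.coeFn_toLp, ← Lp.enorm_def, ← Lp.enorm_def]
  congr 1
  rw [← ofReal_norm, ← ofReal_norm, Lp.norm_fourier_eq]

theorem outFT_eq_fourier (f : ℝ → ℂ) (p : ℝ) :
    outFT f p = ((Real.sqrt (2 * Real.pi))⁻¹ : ℝ) * 𝓕 f ((2 * Real.pi)⁻¹ * p) := by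
  rw [outFT, Real.fourier_real_eq_integral_exp_smul]
  congr 1
  refine integral_congr_ae (ae_of_all _ fun y => ?_)
  simp only [smul_eq_mul]
  congr 2
  have : (Real.pi : ℂ) ≠ 0 := by exact_mod_cast Real.pi_ne_zero
  push_cast
  field_simp

theorem continuous_outFT {f : ℝ → ℂ} (hf : Integrable f) : Continuous (outFT f) := by
  have := continuous_fourier_of_integrable hf
  simp only [funext (outFT_eq_fourier f)]
  fun_prop

theorem lintegral_comp_mul_left {a : ℝ} (ha : 0 < a) (g : ℝ → ℝ≥0∞) (hg : Measurable g) :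
    ∫⁻ x, g (a * x) = ENNReal.ofReal a⁻¹ * ∫⁻ x, g x := by
  rw [← lintegral_map hg (measurable_const_mul a), Real.map_volume_mul_left ha.ne',
    lintegral_smul_measure, abs_of_pos (inv_pos.2 ha), smul_eq_mul]

theorem lintegral_enorm_outFT_sq {f : ℝ → ℂ} (hf : Integrable f) (hf2 : MemLp f 2) :
    ∫⁻ p, ‖outFT f p‖ₑ ^ 2 = ∫⁻ x, ‖f x‖ₑ ^ 2 := by
  have hpi : (0 : ℝ) < 2 * Real.pi := by positivity
  have hm : Measurable fun ξ => ‖𝓕 f ξ‖ₑ ^ 2 :=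
    (continuous_fourier_of_integrable hf).measurable.enorm.pow_const 2
  simp only [outFT_eq_fourier, enorm_mul, mul_pow]
  have hm' : Measurable fun p => ‖𝓕 f ((2 * Real.pi)⁻¹ * p)‖ₑ ^ 2 :=
    hm.comp (measurable_const_mul _)
  -- The factor `2π` from rescaling `p` cancels the square of the prefactor `(2π)^{-1/2}`.
  rw [lintegral_const_mul _ hm', lintegral_comp_mul_left (inv_pos.2 hpi) _ hm, lintegral_enorm_fourier_sq hf hf2, inv_inv,
    ← mul_assoc]
  have : ‖((((Real.sqrt (2 * Real.pi))⁻¹ : ℝ)) : ℂ)‖ₑ ^ 2 = ENNReal.ofReal (2 * Real.pi)⁻¹ := by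
    rw [← ofReal_norm, ← ENNReal.ofReal_pow (norm_nonneg _), Complex.norm_real, Real.norm_eq_abs,
      sq_abs, inv_pow, Real.sq_sqrt hpi.le]
  rw [this, ← ENNReal.ofReal_mul (by positivity), inv_mul_cancel₀ hpi.ne']
  simp

theorem memLp_two_of_integrable_of_bounded {f : ℝ → ℂ} (hf : Integrable f) {M : ℝ}
    (hM : ∀ x, ‖f x‖ ≤ M) : MemLp f 2 := by
  rw [memLp_two_iff_integrable_sq_norm hf.aestronglyMeasurable]
  simp only [pow_two]
  exact hf.norm.bdd_mul (c := M) hf.aestronglyMeasurable.norm (ae_of_all _ fun x => by simpa using hM x)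

/-- Fatou's lemma: a bound uniform along the sequence passes to the pointwise limit. -/
theorem lintegral_enorm_sq_le_of_tendsto {μ : Measure ℝ} {u : ℕ → ℝ → ℂ} {v : ℝ → ℂ}
    (hu : ∀ n, AEStronglyMeasurable (u n) μ)
    (hlim : ∀ᵐ x ∂μ, Tendsto (fun n => u n x) atTop (𝓝 (v x))) {B : ℝ≥0∞}
    (hB : ∀ n, ∫⁻ x, ‖u n x‖ₑ ^ 2 ∂μ ≤ B) : ∫⁻ x, ‖v x‖ₑ ^ 2 ∂μ ≤ B := by
  calc ∫⁻ x, ‖v x‖ₑ ^ 2 ∂μ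
      = ∫⁻ x, liminf (fun n => ‖u n x‖ₑ ^ 2) atTop ∂μ := by
        refine lintegral_congr_ae ?_
        filter_upwards [hlim] with x hx
        exact (((ENNReal.continuous_pow 2).tendsto _).comp hx.enorm).liminf_eq.symm
    _ ≤ liminf (fun n => ∫⁻ x, ‖u n x‖ₑ ^ 2 ∂μ) atTop :=
        lintegral_liminf_le' fun n => (hu n).enorm.pow_const 2
    _ ≤ B := liminf_le_of_le (by isBoundedDefault) fun b hb => by
        obtain ⟨n, hn⟩ := hb.exists
        exact hn.trans (hB n)

/-- Frequency side bounded by the position side, for limits of damped functions. -/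
theorem lintegral_enorm_limit_outFT_sq_le {u : ℝ → ℂ} {un : ℕ → ℝ → ℂ} {V : ℝ → ℂ} {M : ℝ}
    (hun : ∀ n, Integrable (un n)) (hM : ∀ n x, ‖un n x‖ ≤ M) (hle : ∀ n x, ‖un n x‖ ≤ ‖u x‖)
    (hlim : ∀ᵐ p, Tendsto (fun n => outFT (un n) p) atTop (𝓝 (V p))) :
    ∫⁻ p, ‖V p‖ₑ ^ 2 ≤ ∫⁻ x, ‖u x‖ₑ ^ 2 := by
  refine lintegral_enorm_sq_le_of_tendsto
    (fun n => (continuous_outFT (hun n)).aestronglyMeasurable) hlim fun n => ?_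
  rw [lintegral_enorm_outFT_sq (hun n) (memLp_two_of_integrable_of_bounded (hun n) (hM n))]
  refine lintegral_mono fun x => ?_
  gcongr
  exact enorm_le_iff_norm_le.2 (hle n x)

/-- Position side of a convolution with a limit of damped kernels bounded by the frequency side. -/
theorem lintegral_enorm_conv_sq_le {g E : ℝ → ℂ} {En : ℕ → ℝ → ℂ} {M : ℝ} {Q : ℝ → ℝ≥0∞}
    (hg : Integrable g) (hEn : ∀ n, Integrable (En n)) (hM : ∀ n x, ‖En n x‖ ≤ M)
    (hlim : ∀ x, Tendsto (fun n => En n x) atTop (𝓝 (E x)))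
    (hQ : ∀ n, ∀ᵐ p, ‖outFT g p * ∫ y : ℝ, Complex.exp (-(Complex.I * p * y)) * En n y‖ₑ ≤ Q p) :
    ∫⁻ s, ‖∫ y, g y * E (s - y)‖ₑ ^ 2 ≤ ∫⁻ p, Q p ^ 2 := by
  have hci : ∀ n, Integrable (fun s => ∫ y, g y * En n (s - y)) := fun n =>
    hg.integrable_convolution (ContinuousLinearMap.mul ℝ ℂ) (hEn n)
  have hbd : ∀ n s, ‖∫ y, g y * En n (s - y)‖ ≤ (∫ y, ‖g y‖) * M := fun n s => by
    rw [← integral_mul_const]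
    refine norm_integral_le_of_norm_le (hg.norm.mul_const M) (ae_of_all _ fun y => ?_)
    rw [norm_mul]
    exact mul_le_mul_of_nonneg_left (hM n _) (norm_nonneg _)
  refine lintegral_enorm_sq_le_of_tendsto (u := fun n s => ∫ y, g y * En n (s - y))
    (fun n => (hci n).aestronglyMeasurable) ?_ fun n => ?_
  · refine ae_of_all _ fun s => ?_
    refine tendsto_integral_of_dominated_convergence (fun y => ‖g y‖ * M) (fun n => ?_)
      (hg.norm.mul_const M) (fun n => ae_of_all _ fun y => ?_) (ae_of_all _ fun y => ?_)
    · refine hg.aestronglyMeasurable.mul ?_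
      exact (((hEn n).comp_sub_left s)).aestronglyMeasurable
    · rw [norm_mul]
      exact mul_le_mul_of_nonneg_left (hM n _) (norm_nonneg _)
    · exact (hlim _).const_mul _
  · rw [← lintegral_enorm_outFT_sq (hci n) (memLp_two_of_integrable_of_bounded (hci n) (hbd n))]
    refine lintegral_mono_ae ?_
    filter_upwards [hQ n] with p hp
    gcongr
    refine le_trans (le_of_eq ?_) hp
    congr 1
    rw [outFT_eq_fourier g]
    have h1 := Real.fourier_mul_convolution_eq hg (hEn n) ((2 * Real.pi)⁻¹ * p)
    have h2 := outFT_eq_fourier (fun s => ∫ y, g y * En n (s - y)) p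
    have h3 := outFT_eq_fourier (En n) p
    have hs : (((Real.sqrt (2 * Real.pi))⁻¹ : ℝ) : ℂ) ≠ 0 := by
      have : (0 : ℝ) < Real.sqrt (2 * Real.pi) := by positivity
      exact_mod_cast (inv_pos.2 this).ne'
    rw [outFT] at h3
    rw [mul_left_cancel₀ hs h3, h2, mul_assoc, ← h1]
    rfl

end Plancherel

/-! ### The Gamma function as a Fourier transform -/

section Gamma

/-- The integrand of Euler's integral in the logarithmic variable. -/
noncomputable def eulerKernel (a r : ℂ) (s : ℝ) : ℂ := Complex.exp (a * s - r * Real.exp s)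

theorem norm_eulerKernel (a r : ℂ) (s : ℝ) :
    ‖eulerKernel a r s‖ = Real.exp (a.re * s - r.re * Real.exp s) := by
  simp [eulerKernel, Complex.norm_exp, Complex.sub_re, Complex.mul_re, Complex.exp_ofReal_re,
    Complex.exp_ofReal_im]

theorem continuous_eulerKernel (a r : ℂ) : Continuous (eulerKernel a r) := by
  unfold eulerKernel; fun_prop

theorem integral_comp_exp_mul (g : ℝ → ℂ) :
    ∫ t in Ioi 0, g t = ∫ s, (Real.exp s : ℂ) * g (Real.exp s) := by
  have := integral_image_eq_integral_abs_deriv_smul (s := univ) (f := Real.exp) (f' := Real.exp)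
    MeasurableSet.univ (fun x _ => (Real.hasDerivAt_exp x).hasDerivWithinAt)
    Real.exp_injective.injOn g
  rw [image_univ, Real.range_exp, Measure.restrict_univ] at this
  simpa only [abs_of_pos (Real.exp_pos _), Complex.real_smul] using this

theorem integrable_comp_exp_mul {g : ℝ → ℂ} (hg : IntegrableOn g (Ioi 0)) :
    Integrable fun s => (Real.exp s : ℂ) * g (Real.exp s) := by
  have := integrableOn_image_iff_integrableOn_abs_deriv_smul (s := univ) (f := Real.exp)
    (f' := Real.exp) MeasurableSet.univ (fun x _ => (Real.hasDerivAt_exp x).hasDerivWithinAt)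
    Real.exp_injective.injOn g
  rw [image_univ, Real.range_exp, integrableOn_univ] at this
  simpa only [abs_of_pos (Real.exp_pos _), Complex.real_smul] using this.1 hg

theorem exp_mul_cpow_exp (a : ℂ) (r : ℂ) (s : ℝ) :
    (Real.exp s : ℂ) * (((Real.exp s : ℝ) : ℂ) ^ (a - 1) *
      Complex.exp (-(r * ((Real.exp s : ℝ) : ℂ)))) = eulerKernel a r s := by
  have h : ((Real.exp s : ℝ) : ℂ) ≠ 0 := by exact_mod_cast (Real.exp_pos s).ne'
  rw [Complex.cpow_def_of_ne_zero h, ← Complex.ofReal_log (Real.exp_pos s).le, Real.log_exp,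
    eulerKernel]
  nth_rewrite 1 [Complex.ofReal_exp]
  rw [← Complex.exp_add, ← Complex.exp_add]
  congr 1
  ring

theorem integrable_eulerKernel_one {a : ℂ} (ha : 0 < a.re) : Integrable (eulerKernel a 1) := by
  have := integrable_comp_exp_mul (Complex.GammaIntegral_convergent ha)
  refine this.congr (ae_of_all _ fun s => ?_)
  rw [← exp_mul_cpow_exp]
  simp only [Complex.ofReal_exp, Complex.ofReal_neg, one_mul]
  ring

theorem integrable_eulerKernel {a r : ℂ} (ha : 0 < a.re) (hr : 0 < r.re) :
    Integrable (eulerKernel a r) := by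
  -- translating the logarithmic variable reduces to unit rate
  have h := ((integrable_eulerKernel_one ha).comp_add_right (Real.log r.re)).norm.const_mul
    (Real.exp (-(a.re * Real.log r.re)))
  refine h.mono' (continuous_eulerKernel a r).aestronglyMeasurable (ae_of_all _ fun s => ?_)
  rw [norm_eulerKernel, norm_eulerKernel, ← Real.exp_add, Real.exp_add s, Real.exp_log hr]
  refine le_of_eq (congrArg _ ?_)
  simp
  ring

theorem integral_eulerKernel_ofReal {a : ℂ} (ha : 0 < a.re) {r : ℝ} (hr : 0 < r) :
    ∫ s, eulerKernel a r s = (r : ℂ) ^ (-a) * Complex.Gamma a := by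
  have h := Complex.integral_cpow_mul_exp_neg_mul_Ioi ha hr
  rw [integral_comp_exp_mul] at h
  simp only [exp_mul_cpow_exp] at h
  rw [h, one_div, Complex.cpow_neg, Complex.inv_cpow]
  rw [Complex.arg_ofReal_of_nonneg hr.le]
  exact Real.pi_pos.ne

/-- Differentiating in `r` brings down `-e^s`, which raises `a` by one. On the ball of radius `Re r
/ 2` the real part stays above `Re r / 2`, and the kernel with that rate dominates. -/
theorem hasDerivAt_integral_eulerKernel {a r : ℂ} (ha : 0 < a.re) (hr : 0 < r.re) :
    HasDerivAt (fun r => ∫ s, eulerKernel a r s) (∫ s, -eulerKernel (a + 1) r s) r := by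
  have hball : Metric.ball r (r.re / 2) ∈ 𝓝 r := Metric.ball_mem_nhds r (by positivity)
  refine (hasDerivAt_integral_of_dominated_loc_of_deriv_le (𝕜 := ℂ)
    (F := fun r s => eulerKernel a r s) (F' := fun r s => -eulerKernel (a + 1) r s)
    (bound := fun s => ‖eulerKernel (a + 1) ((r.re / 2 : ℝ) : ℂ) s‖) hball
    (Eventually.of_forall fun r => (continuous_eulerKernel a r).aestronglyMeasurable)
    (integrable_eulerKernel ha hr) (continuous_eulerKernel (a + 1) r).neg.aestronglyMeasurable
    (ae_of_all _ fun s z hz => ?_) ?_ (ae_of_all _ fun s z _ => ?_)).2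
  · rw [norm_neg, norm_eulerKernel, norm_eulerKernel, Complex.ofReal_re]
    have h1 : |(z - r).re| < r.re / 2 :=
      lt_of_le_of_lt (Complex.abs_re_le_norm _) (by simpa [dist_eq_norm] using hz)
    rw [Complex.sub_re, abs_lt] at h1
    have h2 : r.re / 2 ≤ z.re := by linarith
    gcongr
  · refine (integrable_eulerKernel ?_ ?_).norm
    · simp; linarith
    · simp; linarith
  · have h1 : HasDerivAt (fun z : ℂ => a * s - z * (Real.exp s : ℂ)) (-(1 * (Real.exp s : ℂ))) z :=
      ((hasDerivAt_id z).mul_const _).const_sub _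
    refine h1.cexp.congr_deriv ?_
    rw [eulerKernel, one_mul, mul_neg]
    nth_rewrite 2 [Complex.ofReal_exp]
    rw [← Complex.exp_add]
    congr 2
    ring

/-- Analytic continuation in the rate: both sides are analytic on the right half-plane and agree at
the real points `1 + 1/(n+1)`, which accumulate at `1`. -/
theorem integral_eulerKernel {a r : ℂ} (ha : 0 < a.re) (hr : 0 < r.re) :
    ∫ s, eulerKernel a r s = r ^ (-a) * Complex.Gamma a := by
  set U : Set ℂ := {z | 0 < z.re} with hU
  have hUo : IsOpen U := isOpen_lt continuous_const Complex.continuous_re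
  have h1 : AnalyticOnNhd ℂ (fun z => ∫ s, eulerKernel a z s) U :=
    DifferentiableOn.analyticOnNhd (fun z hz =>
      (hasDerivAt_integral_eulerKernel ha hz).differentiableAt.differentiableWithinAt) hUo
  have h2 : AnalyticOnNhd ℂ (fun z => z ^ (-a) * Complex.Gamma a) U :=
    DifferentiableOn.analyticOnNhd (fun z hz =>
      ((differentiableAt_id.cpow_const (Or.inl hz)).mul_const _).differentiableWithinAt) hUo
  refine h1.eqOn_of_preconnected_of_frequently_eq h2
    (convex_halfSpace_re_gt 0).isPreconnected (z₀ := 1) (by simp [hU]) ?_ hr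
  have hlim : Tendsto (fun n : ℕ => ((1 + 1 / ((n : ℝ) + 1) : ℝ) : ℂ)) atTop (𝓝[≠] 1) := by
    refine tendsto_nhdsWithin_iff.2 ⟨?_, Eventually.of_forall fun n => ?_⟩
    · have := (tendsto_one_div_add_atTop_nhds_zero_nat (𝕜 := ℝ)).const_add 1
      rw [add_zero] at this
      exact (Complex.continuous_ofReal.tendsto 1).comp this
    · have : (0 : ℝ) < 1 / ((n : ℝ) + 1) := by positivity
      have h : (1 + 1 / ((n : ℝ) + 1) : ℝ) ≠ 1 := by linarith
      simpa only [mem_compl_iff, mem_singleton_iff] using fun e => h (by exact_mod_cast e)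
  refine hlim.frequently (Frequently.of_forall fun n => ?_)
  exact integral_eulerKernel_ofReal ha (by positivity)

/-- The modulus of Euler's integrand at `z` is the integrand at `Re z`. -/
theorem norm_Gamma_le {z : ℂ} (hz : 0 < z.re) : ‖Complex.Gamma z‖ ≤ Real.Gamma z.re := by
  have h1 := integral_eulerKernel_ofReal hz one_pos
  have h2 := integral_eulerKernel_ofReal (a := (z.re : ℂ)) (by simpa using hz) one_pos
  simp only [Complex.ofReal_one, Complex.one_cpow, one_mul] at h1 h2
  rw [← h1]
  have h3 : ∫ s, eulerKernel (z.re : ℂ) 1 s = ((∫ s, ‖eulerKernel z 1 s‖ : ℝ) : ℂ) := by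
    rw [← integral_complex_ofReal]
    refine integral_congr_ae (ae_of_all _ fun s => ?_)
    simp only [norm_eulerKernel]
    simp [eulerKernel]
  rw [h3, Complex.Gamma_ofReal] at h2
  rw [← Complex.ofReal_inj.1 h2]
  exact norm_integral_le_integral_norm _

/-- With `z = ε - ip`, `|z Γ(z)| = |Γ(z+1)| ≤ Γ(1+ε) ≤ 1`, the last step by convexity of `Γ` between
`Γ(1) = Γ(2) = 1`; and `|z| ≥ |p|`. The bound is uniform in the damping. -/
theorem norm_Gamma_sub_I_mul_le {ε p : ℝ} (h0 : 0 < ε) (h1 : ε ≤ 1) (hp : p ≠ 0) :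
    ‖Complex.Gamma (ε - Complex.I * p)‖ ≤ 1 / |p| := by
  have hz : (ε - Complex.I * p : ℂ) ≠ 0 := by
    intro h
    have := congrArg Complex.im h
    simp [hp] at this
  have hΓ := norm_Gamma_le (z := ε - Complex.I * p + 1) (by simp; linarith)
  rw [Complex.Gamma_add_one _ hz, norm_mul] at hΓ
  have hconv : Real.Gamma ((1 - ε) • (1 : ℝ) + ε • (2 : ℝ)) ≤
      (1 - ε) • Real.Gamma 1 + ε • Real.Gamma 2 :=
    Real.convexOn_Gamma.2 (mem_Ioi.2 one_pos) (mem_Ioi.2 two_pos) (by linarith) h0.le (by ring)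
  rw [Real.Gamma_one, Real.Gamma_two] at hconv
  have e1 : (ε - Complex.I * p + 1 : ℂ).re = (1 - ε) • (1 : ℝ) + ε • (2 : ℝ) := by
    simp; ring
  rw [e1] at hΓ
  have h2 : |p| ≤ ‖(ε - Complex.I * p : ℂ)‖ := by
    have := Complex.abs_im_le_norm (ε - Complex.I * p : ℂ)
    simpa using this
  have hp' : 0 < |p| := abs_pos.2 hp
  rw [le_div_iff₀ hp']
  have h3 : (1 - ε) • (1 : ℝ) + ε • (1 : ℝ) = 1 := by simp
  rw [h3] at hconv
  calc ‖Complex.Gamma (ε - Complex.I * p)‖ * |p|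
      ≤ ‖Complex.Gamma (ε - Complex.I * p)‖ * ‖(ε - Complex.I * p : ℂ)‖ := by gcongr
    _ ≤ 1 := by rw [mul_comm]; exact hΓ.trans hconv

/-- The reflection formula gives `|Γ(ip)|² = π / (p sinh πp)`, and `sinh ≤ exp`, `π ≥ 1`. -/
theorem le_norm_Gamma_sq {p : ℝ} (hp : 0 < p) :
    1 / p ≤ ‖Complex.Gamma (Complex.I * p)‖ ^ 2 * Real.exp (Real.pi * p) := by
  have hz : (Complex.I * p : ℂ) ≠ 0 := by simp [hp.ne']
  have hrefl := Complex.Gamma_mul_Gamma_one_sub (-(Complex.I * p))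
  have hconj : Complex.Gamma (-(Complex.I * p)) =
      (starRingEnd ℂ) (Complex.Gamma (Complex.I * p)) := by
    rw [← Complex.Gamma_conj]; simp
  have hsin : Complex.sin (Real.pi * -(Complex.I * p)) =
      -((Real.sinh (Real.pi * p) : ℝ) : ℂ) * Complex.I := by
    rw [show (Real.pi * -(Complex.I * p) : ℂ) = -(((Real.pi * p : ℝ) : ℂ) * Complex.I) by
      push_cast; ring, Complex.sin_neg, Complex.sin_mul_I, Complex.ofReal_sinh]
    ring
  rw [sub_neg_eq_add, add_comm (1 : ℂ), Complex.Gamma_add_one _ hz, hsin, hconj] at hrefl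
  have hn := congrArg (fun z : ℂ => ‖z‖) hrefl
  simp only [norm_mul, norm_div, norm_neg, Complex.norm_I, RCLike.norm_conj, Complex.norm_real,
    Real.norm_eq_abs, mul_one, one_mul] at hn
  have hs : 0 < Real.sinh (Real.pi * p) := Real.sinh_pos_iff.2 (by positivity)
  rw [abs_of_pos hp, abs_of_pos Real.pi_pos, abs_of_pos hs, eq_div_iff hs.ne'] at hn
  have hsle : Real.sinh (Real.pi * p) ≤ Real.exp (Real.pi * p) := by
    rw [Real.sinh_eq]
    have := Real.exp_pos (Real.pi * p)
    have := Real.exp_pos (-(Real.pi * p))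
    linarith
  rw [div_le_iff₀ hp]
  calc (1 : ℝ) ≤ Real.pi := by linarith [Real.pi_gt_three]
    _ = ‖Complex.Gamma (Complex.I * p)‖ ^ 2 * p * Real.sinh (Real.pi * p) := by
        linear_combination -hn
    _ ≤ ‖Complex.Gamma (Complex.I * p)‖ ^ 2 * p * Real.exp (Real.pi * p) := by gcongr
    _ = _ := by ring

end Gamma

/-! ### Spontaneous production is finite -/

section Spontaneous

/-- `∫ |f~(p)|² / p² dp`. -/
noncomputable def primitiveNorm (g : ℝ → ℂ) : ℝ≥0∞ :=
  ∫⁻ p, (‖outFT g p‖ₑ * ENNReal.ofReal (1 / |p|)) ^ 2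

/-- A regularizing sequence. -/
noncomputable def damping (n : ℕ) : ℝ := 1 / ((n : ℝ) + 1)

theorem damping_pos (n : ℕ) : 0 < damping n := by unfold damping; positivity

theorem damping_le_one (n : ℕ) : damping n ≤ 1 := by
  unfold damping
  rw [div_le_one (by positivity)]
  linarith [(Nat.cast_nonneg n : (0 : ℝ) ≤ n)]

theorem tendsto_damping : Tendsto damping atTop (𝓝 0) := tendsto_one_div_add_atTop_nhds_zero_nat

theorem tendsto_damping_complex : Tendsto (fun n => (damping n : ℂ)) atTop (𝓝 0) := by
  rw [← Complex.ofReal_zero]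
  exact (Complex.continuous_ofReal.tendsto 0).comp tendsto_damping

/-- The exponent has real part `ε (s - e^s) ≤ 0`: the two dampings, at `s → -∞` and at `s → +∞`,
balance so that the kernel never exceeds `1`. -/
theorem norm_eulerKernel_damping_le {a r : ℂ} {ε : ℝ} (hε : 0 ≤ ε) (ha : a.re = ε) (hr : r.re = ε)
    (s : ℝ) : ‖eulerKernel a r s‖ ≤ 1 := by
  rw [norm_eulerKernel, Real.exp_le_one_iff, ha, hr, ← mul_sub]
  exact mul_nonpos_of_nonneg_of_nonpos hε (by linarith [Real.add_one_le_exp s])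

theorem enorm_mul_le_of_norm_le_one_div {z w : ℂ} {p : ℝ} (h : ‖w‖ ≤ 1 / |p|) :
    ‖z * w‖ₑ ≤ ‖z‖ₑ * ENNReal.ofReal (1 / |p|) := by
  rw [enorm_mul, ← ofReal_norm w]
  gcongr

theorem ae_ne_zero : ∀ᵐ p : ℝ, p ≠ 0 := by
  simp [ae_iff]

/-- The primitive is the convolution with the Heaviside function. Damped by `e^{-εs}`, this has
transform `1/(ε + ip)` up to normalization, of modulus at most `1/|p|`. -/
theorem lintegral_enorm_primitive_sq_le {g : ℝ → ℂ} (hg : Integrable g) :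
    ∫⁻ s, ‖∫ y in Iio s, g y‖ₑ ^ 2 ≤ primitiveNorm g := by
  have hexp : ∀ n, IntegrableOn (fun s : ℝ => Complex.exp (-(damping n : ℂ) * s)) (Ioi 0) :=
    fun n => integrableOn_exp_mul_complex_Ioi (by simpa using damping_pos n) 0
  have := lintegral_enorm_conv_sq_le (g := g) (E := (Ioi 0).indicator fun _ => 1)
    (En := fun n => (Ioi 0).indicator fun s => Complex.exp (-(damping n : ℂ) * s)) (M := 1)
    (Q := fun p => ‖outFT g p‖ₑ * ENNReal.ofReal (1 / |p|)) hg
    (fun n => (hexp n).integrable_indicator measurableSet_Ioi) (fun n s => ?_) (fun s => ?_)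
    (fun n => ?_)
  · refine le_trans (le_of_eq (lintegral_congr fun s => ?_)) this
    congr 2
    rw [← integral_indicator measurableSet_Iio]
    refine integral_congr_ae (ae_of_all _ fun y => ?_)
    by_cases h : y < s <;> simp [indicator, h]
  · by_cases h : 0 < s
    · rw [indicator_of_mem (mem_Ioi.2 h), Complex.norm_exp, Real.exp_le_one_iff]
      have := mul_pos (damping_pos n) h
      simp; linarith
    · simp [indicator, h]
  · by_cases h : 0 < s
    · simp only [indicator_of_mem (mem_Ioi.2 h)]
      have := (tendsto_damping_complex.neg.mul_const (s : ℂ)).cexp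
      simpa using this
    · simp [indicator, h]
  · filter_upwards [ae_ne_zero] with p hp
    refine enorm_mul_le_of_norm_le_one_div ?_
    have hre : (-(damping n : ℂ) - Complex.I * p).re < 0 := by simpa using damping_pos n
    have e : ∫ y : ℝ, Complex.exp (-(Complex.I * p * y)) *
        (Ioi (0 : ℝ)).indicator (fun s => Complex.exp (-(damping n : ℂ) * s)) y =
        ∫ y : ℝ in Ioi 0, Complex.exp ((-(damping n : ℂ) - Complex.I * p) * y) := by
      rw [← integral_indicator measurableSet_Ioi]
      refine integral_congr_ae (ae_of_all _ fun y => ?_)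
      by_cases h : 0 < y
      · simp only [indicator_of_mem (mem_Ioi.2 h), ← Complex.exp_add]
        congr 1; ring
      · simp [indicator, h]
    rw [e, integral_exp_mul_complex_Ioi hre]
    simp only [Complex.ofReal_zero, mul_zero, Complex.exp_zero, norm_div, norm_neg, norm_one]
    have h2 : |p| ≤ ‖(-(damping n : ℂ) - Complex.I * p)‖ := by
      have := Complex.abs_im_le_norm (-(damping n : ℂ) - Complex.I * p)
      simpa using this
    exact one_div_le_one_div_of_le (abs_pos.2 hp) h2

theorem integral_exp_mul_eulerKernel {ε : ℝ} (hε : 0 < ε) (p : ℝ) {r : ℂ} (hr : r.re = ε) :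
    ∫ y : ℝ, Complex.exp (-(Complex.I * p * y)) * eulerKernel ε r y =
      r ^ (-(ε - Complex.I * p)) * Complex.Gamma (ε - Complex.I * p) := by
  rw [← integral_eulerKernel (by simpa using hε) (by rwa [hr])]
  refine integral_congr_ae (ae_of_all _ fun y => ?_)
  simp only [eulerKernel, ← Complex.exp_add]
  congr 1; ring

/-- Production by the exponential (Rindler) map of a wave with positive momenta. -/
theorem lintegral_enorm_rindler_sq_le {g : ℝ → ℂ} (hg : Integrable g)
    (hpos : ∀ p < 0, outFT g p = 0) :
    ∫⁻ s : ℝ, ‖∫ y, g y * Complex.exp (-(Complex.I * Real.exp (s - y)))‖ₑ ^ 2 ≤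
      primitiveNorm g := by
  refine lintegral_enorm_conv_sq_le (g := g)
    (E := fun s => Complex.exp (-(Complex.I * Real.exp s)))
    (En := fun n => eulerKernel (damping n) (damping n + Complex.I)) (M := 1)
    (Q := fun p => ‖outFT g p‖ₑ * ENNReal.ofReal (1 / |p|)) hg
    (fun n => integrable_eulerKernel (by simpa using damping_pos n)
      (by simpa using damping_pos n))
    (fun n s => norm_eulerKernel_damping_le (damping_pos n).le (by simp) (by simp) s)
    (fun s => ?_) (fun n => ?_)
  · have h1 := ((tendsto_damping_complex.mul_const (s : ℂ)).sub
      ((tendsto_damping_complex.add_const Complex.I).mul_const (Real.exp s : ℂ))).cexp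
    simpa [eulerKernel] using h1
  · filter_upwards [ae_ne_zero] with p hp
    rcases lt_or_gt_of_ne hp with hneg | hp0
    · simp [hpos p hneg]
    refine enorm_mul_le_of_norm_le_one_div ?_
    rw [integral_exp_mul_eulerKernel (damping_pos n) p (by simp), norm_mul]
    have hΓ := norm_Gamma_sub_I_mul_le (damping_pos n) (damping_le_one n) hp
    have hz : (damping n + Complex.I : ℂ) ≠ 0 := by
      intro h
      have := congrArg Complex.im h
      simp at this
    have hn : 1 ≤ ‖(damping n + Complex.I : ℂ)‖ := by
      have := Complex.abs_im_le_norm (damping n + Complex.I : ℂ)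
      simpa using this
    -- The argument of `ε + i` is nonnegative, so `|(ε + i)^{ip}| = e^{-p arg} ≤ 1` for `p > 0`;
    -- this is where positivity of the momenta enters.
    have hc : ‖(damping n + Complex.I : ℂ) ^ (-(damping n - Complex.I * p))‖ ≤ 1 := by
      rw [Complex.norm_cpow_of_ne_zero hz]
      have h1 : ‖(damping n + Complex.I : ℂ)‖ ^ (-(damping n - Complex.I * p) : ℂ).re ≤ 1 :=
        Real.rpow_le_one_of_one_le_of_nonpos hn (by simpa using (damping_pos n).le)
      have h2 : 1 ≤ Real.exp
          ((damping n + Complex.I : ℂ).arg * (-(damping n - Complex.I * p) : ℂ).im) := by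
        rw [Real.one_le_exp_iff]
        refine mul_nonneg (Complex.arg_nonneg_iff.2 (by simp)) (by simpa using hp0.le)
      exact div_le_one_of_le₀ (h1.trans h2) (by positivity)
    calc _ ≤ 1 * (1 / |p|) := by gcongr
      _ = _ := one_mul _

theorem exp_neg_xIn (y : ℝ) : Real.exp (-xIn y) = 1 + Real.exp (-y) := by
  rw [xIn, neg_neg, Real.exp_log (by positivity)]

theorem continuous_xIn : Continuous xIn := by
  unfold xIn
  exact (Continuous.log (by fun_prop) fun y => by positivity).neg

theorem xIn_neg (y : ℝ) : xIn y < 0 := by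
  have : (1 : ℝ) < 1 + Real.exp (-y) := by linarith [Real.exp_pos (-y)]
  have := Real.log_pos this
  unfold xIn
  linarith

theorem one_le_exp_neg_xIn (y : ℝ) : 1 ≤ Real.exp (-xIn y) :=
  Real.one_le_exp (by linarith [xIn_neg y])

theorem norm_add_I_mul_cpow_le {ε v p : ℝ} (hε : 0 < ε) (hv : 1 ≤ v) :
    ‖(ε + Complex.I * v : ℂ) ^ (-(ε - Complex.I * p))‖ ≤ Real.exp (Real.pi * |p|) := by
  have hz : (ε + Complex.I * v : ℂ) ≠ 0 := by
    intro h
    have := congrArg Complex.im h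
    simp at this
    linarith
  have hn : 1 ≤ ‖(ε + Complex.I * v : ℂ)‖ := by
    have := Complex.abs_im_le_norm (ε + Complex.I * v : ℂ)
    simp at this
    exact (hv.trans (le_abs_self v)).trans this
  rw [Complex.norm_cpow_of_ne_zero hz]
  have h1 : ‖(ε + Complex.I * v : ℂ)‖ ^ (-(ε - Complex.I * p) : ℂ).re ≤ 1 :=
    Real.rpow_le_one_of_one_le_of_nonpos hn (by simpa using hε.le)
  rw [div_le_iff₀ (Real.exp_pos _), ← Real.exp_add]
  refine h1.trans (Real.one_le_exp ?_)
  have h2 := Complex.abs_arg_le_pi (ε + Complex.I * v : ℂ)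
  have h3 : (-(ε - Complex.I * p) : ℂ).im = p := by simp
  rw [h3]
  have h4 : |(ε + Complex.I * v : ℂ).arg * p| ≤ Real.pi * |p| := by
    rw [abs_mul]; gcongr
  linarith [neg_abs_le ((ε + Complex.I * v : ℂ).arg * p)]

theorem I_mul_cpow {x p : ℝ} :
    (Complex.I * (Real.exp (-x) : ℝ) : ℂ) ^ (Complex.I * p) =
      (Real.exp (-(Real.pi * p / 2)) : ℝ) * Complex.exp (-(Complex.I * p * x)) := by
  have hv : (0 : ℝ) < Real.exp (-x) := Real.exp_pos _
  have hne : (Complex.I * (Real.exp (-x) : ℝ) : ℂ) ≠ 0 :=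
    mul_ne_zero Complex.I_ne_zero (by exact_mod_cast hv.ne')
  rw [Complex.cpow_def_of_ne_zero hne, mul_comm Complex.I ((Real.exp (-x) : ℝ) : ℂ),
    Complex.log_ofReal_mul hv Complex.I_ne_zero, Real.log_exp, Complex.log_I, Complex.ofReal_exp,
    ← Complex.exp_add]
  congr 1
  push_cast
  linear_combination (Real.pi * p / 2 : ℂ) * Complex.I_mul_I

/-- Negative momenta in terms of the Mellin transform of the wave seen through `e^{-x}`. -/
theorem lintegral_enorm_inFT_neg_le {g : ℝ → ℂ} (hg : Integrable g) :
    ∫⁻ k in Ioi (0 : ℝ), ‖inFT g (-k)‖ₑ ^ 2 * ENNReal.ofReal (1 / k) ≤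
      ∫⁻ s : ℝ, ‖∫ y, g y * Complex.exp (-(Complex.I * Real.exp s * Real.exp (-xIn y)))‖ₑ ^ 2 := by
  set u : ℝ → ℂ := fun s => ∫ y, g y * Complex.exp (-(Complex.I * Real.exp s * Real.exp (-xIn y)))
  have hcx := continuous_xIn
  have hu_bd : ∀ s, ‖u s‖ ≤ ∫ y, ‖g y‖ := fun s => by
    refine norm_integral_le_of_norm_le hg.norm (ae_of_all _ fun y => ?_)
    rw [norm_mul, Complex.norm_exp]
    simp [-Complex.ofReal_exp, Complex.mul_re]
  have hker : ∀ n s, ‖eulerKernel (damping n) (damping n) s‖ ≤ 1 := fun n s =>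
    norm_eulerKernel_damping_le (damping_pos n).le (by simp) (by simp) s
  have hkeri : ∀ n, Integrable (eulerKernel (damping n) (damping n)) := fun n =>
    integrable_eulerKernel (by simpa using damping_pos n) (by simpa using damping_pos n)
  have hu_c : Continuous u := by
    refine continuous_of_dominated (bound := fun y => ‖g y‖) (fun s => ?_) (fun s => ?_) hg.norm ?_
    · refine hg.aestronglyMeasurable.mul (Continuous.aestronglyMeasurable ?_)
      fun_prop
    · refine ae_of_all _ fun y => ?_
      rw [norm_mul, Complex.norm_exp]
      simp [-Complex.ofReal_exp, Complex.mul_re]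
    · refine ae_of_all _ fun y => ?_
      fun_prop
  -- Damping makes `u` integrable and moves the rate `i e^{-x}` of the oscillation to `ε + i
  -- e^{-x}`, inside the half-plane where Euler's integral is known.
  set un : ℕ → ℝ → ℂ := fun n s => u s * eulerKernel (damping n) (damping n) s
  have hun_le : ∀ n s, ‖un n s‖ ≤ ‖u s‖ := fun n s => by
    simp only [un, norm_mul]
    exact mul_le_of_le_one_right (norm_nonneg _) (hker n s)
  have hun_i : ∀ n, Integrable (un n) := fun n =>
    (hkeri n).bdd_mul hu_c.aestronglyMeasurable (ae_of_all _ hu_bd)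
  -- The limit `ε → 0` of the transforms: `(i e^{-x})^{ip}` splits into `e^{-πp/2}` and the incoming
  -- plane wave `e^{-ipx}`.
  set V : ℝ → ℂ := fun p =>
    Complex.Gamma (-(Complex.I * p)) * (Real.exp (-(Real.pi * p / 2)) : ℝ) * inFT g p
  have hFT : ∀ n p, outFT (un n) p = ((Real.sqrt (2 * Real.pi))⁻¹ : ℝ) *
      (∫ y, g y * (damping n + Complex.I * (Real.exp (-xIn y) : ℝ) : ℂ) ^
        (-(damping n - Complex.I * p))) * Complex.Gamma (damping n - Complex.I * p) := by
    intro n p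
    have hid : ∀ s y : ℝ, Complex.exp (-(Complex.I * p * s)) *
        ((g y * Complex.exp (-(Complex.I * Real.exp s * Real.exp (-xIn y)))) *
          eulerKernel (damping n) (damping n) s) =
        g y * (Complex.exp (-(Complex.I * p * s)) *
          eulerKernel (damping n) (damping n + Complex.I * (Real.exp (-xIn y) : ℝ)) s) := by
      intro s y
      have : eulerKernel (damping n) (damping n + Complex.I * (Real.exp (-xIn y) : ℝ)) s =
          Complex.exp (-(Complex.I * Real.exp s * Real.exp (-xIn y))) *
            eulerKernel (damping n) (damping n) s := by
        simp only [eulerKernel, ← Complex.exp_add]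
        congr 1; ring
      rw [this]; ring
    have hprod : Integrable (Function.uncurry fun s y : ℝ => Complex.exp (-(Complex.I * p * s)) *
        ((g y * Complex.exp (-(Complex.I * Real.exp s * Real.exp (-xIn y)))) *
          eulerKernel (damping n) (damping n) s)) (volume.prod volume) := by
      refine ((hkeri n).mul_prod hg).bdd_mul (c := 1) (f := fun z : ℝ × ℝ =>
        Complex.exp (-(Complex.I * p * z.1)) *
          Complex.exp (-(Complex.I * Real.exp z.1 * Real.exp (-xIn z.2)))) ?_ ?_ |>.congr ?_
      · refine Continuous.aestronglyMeasurable ?_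
        fun_prop
      · refine ae_of_all _ fun z => ?_
        rw [← Complex.exp_add, Complex.norm_exp]
        simp [-Complex.ofReal_exp, Complex.mul_re]
      · refine ae_of_all _ fun z => ?_
        simp only [Function.uncurry]
        ring
    rw [outFT, mul_assoc]
    congr 1
    calc ∫ s : ℝ, Complex.exp (-(Complex.I * p * s)) * un n s
        = ∫ s : ℝ, ∫ y : ℝ, Complex.exp (-(Complex.I * p * s)) *
          ((g y * Complex.exp (-(Complex.I * Real.exp s * Real.exp (-xIn y)))) *
            eulerKernel (damping n) (damping n) s) := by
          refine integral_congr_ae (ae_of_all _ fun s => ?_)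
          simp only [un, u]
          rw [integral_const_mul, integral_mul_const]
      _ = ∫ y : ℝ, ∫ s : ℝ, Complex.exp (-(Complex.I * p * s)) *
          ((g y * Complex.exp (-(Complex.I * Real.exp s * Real.exp (-xIn y)))) *
            eulerKernel (damping n) (damping n) s) := integral_integral_swap hprod
      _ = _ := by
          rw [← integral_mul_const]
          refine integral_congr_ae (ae_of_all _ fun y => ?_)
          simp only [hid]
          rw [integral_const_mul, integral_exp_mul_eulerKernel (damping_pos n) p
            (by simp [-Complex.ofReal_exp, Complex.mul_re]), mul_assoc]
  have hlim : ∀ᵐ p : ℝ, Tendsto (fun n => outFT (un n) p) atTop (𝓝 (V p)) := by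
    filter_upwards [ae_ne_zero] with p hp
    simp only [hFT]
    have h1 : Tendsto (fun n => ∫ y, g y *
        (damping n + Complex.I * (Real.exp (-xIn y) : ℝ) : ℂ) ^ (-(damping n - Complex.I * p)))
        atTop (𝓝 (∫ y, g y * ((Real.exp (-(Real.pi * p / 2)) : ℝ) *
          Complex.exp (-(Complex.I * p * xIn y))))) := by
      refine tendsto_integral_of_dominated_convergence
        (fun y => ‖g y‖ * Real.exp (Real.pi * |p|)) (fun n => ?_) (hg.norm.mul_const _)
        (fun n => ae_of_all _ fun y => ?_) (ae_of_all _ fun y => ?_)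
      · refine hg.aestronglyMeasurable.mul (Continuous.aestronglyMeasurable ?_)
        refine Continuous.cpow (by fun_prop) continuous_const fun y => Or.inl ?_
        simpa [-Complex.ofReal_exp, Complex.mul_re] using damping_pos n
      · rw [norm_mul]
        gcongr
        exact norm_add_I_mul_cpow_le (damping_pos n) (one_le_exp_neg_xIn y)
      · refine Tendsto.const_mul _ ?_
        rw [← I_mul_cpow]
        refine Tendsto.cpow ?_ ?_ (Or.inr ?_)
        · simpa using tendsto_damping_complex.add_const (Complex.I * (Real.exp (-xIn y) : ℝ))
        · simpa using (tendsto_damping_complex.sub_const (Complex.I * p)).neg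
        · simp [-Complex.ofReal_exp, Complex.mul_im, (Real.exp_pos (-xIn y)).ne']
    have h2 : Tendsto (fun n => Complex.Gamma (damping n - Complex.I * p)) atTop
        (𝓝 (Complex.Gamma (-(Complex.I * p)))) := by
      have hc : ContinuousAt Complex.Gamma (-(Complex.I * p)) :=
        Complex.continuousAt_Gamma _ fun m h => by
          have := congrArg Complex.im h
          simp [hp] at this
      refine hc.tendsto.comp ?_
      simpa using tendsto_damping_complex.sub_const (Complex.I * p)
    have h3 := (h1.const_mul (((Real.sqrt (2 * Real.pi))⁻¹ : ℝ) : ℂ)).mul h2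
    convert h3 using 2
    simp only [V, inFT]
    have : ∀ y : ℝ, g y * ((Real.exp (-(Real.pi * p / 2)) : ℝ) *
        Complex.exp (-(Complex.I * p * xIn y))) = (Real.exp (-(Real.pi * p / 2)) : ℝ) *
        (Complex.exp (-(Complex.I * p * xIn y)) * g y) := fun y => by ring
    simp only [this]
    rw [integral_const_mul]
    ring
  have hV := lintegral_enorm_limit_outFT_sq_le hun_i
    (fun n s => (hun_le n s).trans (hu_bd s)) hun_le hlim
  refine le_trans ?_ hV
  have hVneg : ∫⁻ p, ‖V p‖ₑ ^ 2 = ∫⁻ p, ‖V (-p)‖ₑ ^ 2 := by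
    have := (Measure.measurePreserving_neg (volume : Measure ℝ)).lintegral_comp_emb
      (MeasurableEquiv.neg ℝ).measurableEmbedding (fun p => ‖V p‖ₑ ^ 2)
    exact this.symm
  rw [hVneg]
  refine le_trans (setLIntegral_mono' measurableSet_Ioi fun k hk => ?_)
    (setLIntegral_le_lintegral _ _)
  have hk : 0 < k := hk
  rw [← ofReal_norm, ← ofReal_norm, ← ENNReal.ofReal_pow (norm_nonneg _),
    ← ENNReal.ofReal_pow (norm_nonneg _), ← ENNReal.ofReal_mul (by positivity)]
  refine ENNReal.ofReal_le_ofReal ?_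
  -- At `p = -k` the factor `e^{πk}` compensates the decay of `|Γ(ik)|²`, leaving at least `1/k`.
  have hΓ := le_norm_Gamma_sq hk
  have e1 : ‖V (-k)‖ ^ 2 = ‖inFT g (-k)‖ ^ 2 *
      (‖Complex.Gamma (Complex.I * k)‖ ^ 2 * Real.exp (Real.pi * k)) := by
    simp only [V]
    rw [norm_mul, norm_mul, Complex.norm_real, Real.norm_eq_abs, abs_of_pos (Real.exp_pos _),
      mul_pow, mul_pow, ← Real.exp_nat_mul]
    have : (-(Complex.I * ((-k : ℝ) : ℂ))) = Complex.I * k := by push_cast; ring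
    rw [this]
    have : ((2 : ℕ) : ℝ) * -(Real.pi * -k / 2) = Real.pi * k := by push_cast; ring
    rw [this]
    ring
  rw [e1]
  gcongr

/-- Since `e^{-x(y)} = 1 + e^{-y}`, the black-hole map differs from the pure exponential map only by
the phase `exp(-i e^s)`. It does not depend on `y`, so it drops out of the modulus. -/
theorem lintegral_enorm_inFT_neg_le_primitiveNorm {g : ℝ → ℂ} (hg : Integrable g)
    (hpos : ∀ p < 0, outFT g p = 0) :
    ∫⁻ k in Ioi (0 : ℝ), ‖inFT g (-k)‖ₑ ^ 2 * ENNReal.ofReal (1 / k) ≤ primitiveNorm g := by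
  refine (lintegral_enorm_inFT_neg_le hg).trans
    (le_trans (le_of_eq (lintegral_congr fun s => ?_)) (lintegral_enorm_rindler_sq_le hg hpos))
  have e : ∀ y : ℝ, g y * Complex.exp (-(Complex.I * Real.exp s * Real.exp (-xIn y))) =
      Complex.exp (-(Complex.I * Real.exp s)) *
        (g y * Complex.exp (-(Complex.I * Real.exp (s - y)))) := fun y => by
    rw [exp_neg_xIn, mul_left_comm, ← Complex.exp_add, sub_eq_add_neg s y, Real.exp_add]
    congr 2
    push_cast; ring
  simp only [e]
  rw [integral_const_mul, enorm_mul]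
  have : ‖Complex.exp (-(Complex.I * Real.exp s))‖ₑ = 1 := by
    rw [← ofReal_norm, Complex.norm_exp]
    simp [-Complex.ofReal_exp, Complex.mul_re]
  rw [this, one_mul]

end Spontaneous

/-! ### The infrared estimate -/

section Infrared

theorem hasDerivAt_xIn (y : ℝ) : HasDerivAt xIn (1 / (1 + Real.exp y)) y := by
  have h1 : HasDerivAt (fun y => 1 + Real.exp (-y)) (Real.exp (-y) * -1) y :=
    ((hasDerivAt_neg y).exp).const_add 1
  refine ((h1.log (by positivity)).neg).congr_deriv ?_
  rw [Real.exp_neg]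
  field_simp
  ring

theorem strictMono_xIn : StrictMono xIn := fun a b hab => by
  unfold xIn
  have : Real.exp (-b) < Real.exp (-a) := Real.exp_lt_exp.2 (by linarith)
  have := Real.log_lt_log (by positivity) (by linarith : 1 + Real.exp (-b) < 1 + Real.exp (-a))
  linarith

theorem range_xIn : range xIn = Iio 0 := by
  refine Subset.antisymm (range_subset_iff.2 xIn_neg) fun x hx => ?_
  have hx : x < 0 := hx
  have h1 : 0 < Real.exp (-x) - 1 := by
    have := Real.one_lt_exp_iff.2 (by linarith : 0 < -x)
    linarith
  refine ⟨-Real.log (Real.exp (-x) - 1), ?_⟩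
  rw [xIn, neg_neg, Real.exp_log h1]
  simp

theorem continuous_inFT {g : ℝ → ℂ} (hg : Integrable g) : Continuous (inFT g) := by
  have hcx := continuous_xIn
  refine continuous_const.mul ?_
  refine continuous_of_dominated (bound := fun y => ‖g y‖) (fun k => ?_) (fun k => ?_) hg.norm ?_
  · exact (Continuous.aestronglyMeasurable (by fun_prop)).mul hg.aestronglyMeasurable
  · refine ae_of_all _ fun y => ?_
    rw [norm_mul, Complex.norm_exp]
    simp
  · exact ae_of_all _ fun y => by fun_prop

/-- The primitive of a wave in the incoming coordinate. -/
noncomputable def inPrimitive (g : ℝ → ℂ) (x : ℝ) : ℂ :=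
  ∫ y, {z : ℝ × ℝ | xIn z.2 < z.1 ∧ z.1 < 0}.indicator (fun z => g z.2) (x, y)

theorem measurableSet_inRegion : MeasurableSet {z : ℝ × ℝ | xIn z.2 < z.1 ∧ z.1 < 0} :=
  (measurableSet_lt (continuous_xIn.measurable.comp measurable_snd) measurable_fst).inter
    (measurableSet_lt measurable_fst measurable_const)

theorem inPrimitive_of_nonneg (g : ℝ → ℂ) {x : ℝ} (hx : 0 ≤ x) : inPrimitive g x = 0 := by
  simp [inPrimitive, indicator, not_lt.2 hx]

theorem inPrimitive_xIn (g : ℝ → ℂ) (y : ℝ) : inPrimitive g (xIn y) = ∫ t in Iio y, g t := by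
  rw [inPrimitive, ← integral_indicator measurableSet_Iio]
  refine integral_congr_ae (ae_of_all _ fun t => ?_)
  simp [indicator, xIn_neg y, strictMono_xIn.lt_iff_lt]

theorem norm_inPrimitive_le {g : ℝ → ℂ} (hg : Integrable g) (x : ℝ) :
    ‖inPrimitive g x‖ ≤ ∫ y, ‖g y‖ := by
  refine norm_integral_le_of_norm_le hg.norm (ae_of_all _ fun y => ?_)
  exact norm_indicator_le_norm_self _ _

theorem aestronglyMeasurable_inPrimitive {g : ℝ → ℂ} (hg : Integrable g) :
    AEStronglyMeasurable (inPrimitive g) volume := by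
  refine AEStronglyMeasurable.integral_prod_right' (f := fun z : ℝ × ℝ =>
    {z : ℝ × ℝ | xIn z.2 < z.1 ∧ z.1 < 0}.indicator (fun z => g z.2) z) ?_
  exact hg.aestronglyMeasurable.comp_snd.indicator measurableSet_inRegion

theorem integrable_indicator_exp {c : ℂ} (hc : 0 < c.re) :
    Integrable ((Iio (0 : ℝ)).indicator fun x : ℝ => Complex.exp (c * x)) := by
  refine IntegrableOn.integrable_indicator ?_ measurableSet_Iio
  exact (integrableOn_exp_mul_complex_Iic hc 0).mono_set Iio_subset_Iic_self

theorem integral_exp_mul_inRegion {c : ℂ} (hc : c ≠ 0) (g : ℝ → ℂ) (y : ℝ) :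
    ∫ x : ℝ, Complex.exp (c * x) *
        {z : ℝ × ℝ | xIn z.2 < z.1 ∧ z.1 < 0}.indicator (fun z => g z.2) (x, y) =
      (g y - Complex.exp (c * xIn y) * g y) / c := by
  have e : ∀ x : ℝ, Complex.exp (c * x) *
      {z : ℝ × ℝ | xIn z.2 < z.1 ∧ z.1 < 0}.indicator (fun z => g z.2) (x, y) =
      (Ioo (xIn y) 0).indicator (fun x : ℝ => Complex.exp (c * x) * g y) x := fun x => by
    by_cases h : xIn y < x ∧ x < 0 <;> simp [indicator, h]
  simp only [e]
  rw [integral_indicator measurableSet_Ioo, ← integral_Ioc_eq_integral_Ioo,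
    ← intervalIntegral.integral_of_le (xIn_neg y).le, intervalIntegral.integral_mul_const,
    integral_exp_mul_complex hc]
  simp
  ring

/-- Integrating `e^{cx}` over `x(y) < x < 0` gives `(1 - e^{c x(y)})/c`; the constant term
disappears because `∫ g = 0`. The primitive is only bounded, so it is damped by `e^{εx}`, that is `c
= ε - ik`. -/
theorem lintegral_enorm_inFT_div_sq_le_inPrimitive {g : ℝ → ℂ} (hg : Integrable g)
    (h0 : ∫ y, g y = 0) :
    ∫⁻ k, (‖inFT g k‖ₑ * ENNReal.ofReal (1 / |k|)) ^ 2 ≤ ∫⁻ x, ‖inPrimitive g x‖ₑ ^ 2 := by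
  have hcx := continuous_xIn
  set un : ℕ → ℝ → ℂ := fun n x => Complex.exp ((damping n : ℂ) * x) * inPrimitive g x
  have hnorm : ∀ n x, ‖un n x‖ = Real.exp (damping n * x) * ‖inPrimitive g x‖ := fun n x => by
    simp only [un]
    rw [norm_mul, Complex.norm_exp]
    simp
  have hle : ∀ n x, ‖un n x‖ ≤ ‖inPrimitive g x‖ := fun n x => by
    rcases le_or_gt 0 x with hx | hx
    · simp [un, inPrimitive_of_nonneg g hx]
    · rw [hnorm]
      refine mul_le_of_le_one_left (norm_nonneg _) (Real.exp_le_one_iff.2 ?_)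
      exact mul_nonpos_of_nonneg_of_nonpos (damping_pos n).le hx.le
  have hun_i : ∀ n, Integrable (un n) := fun n => by
    refine ((integrable_indicator_exp (c := (damping n : ℂ))
      (by simpa using damping_pos n)).norm.mul_const (∫ y, ‖g y‖)).mono' ?_
      (ae_of_all _ fun x => ?_)
    · exact (Continuous.aestronglyMeasurable (by fun_prop)).mul
        (aestronglyMeasurable_inPrimitive hg)
    · rcases le_or_gt 0 x with hx | hx
      · simp [un, inPrimitive_of_nonneg g hx, hx]
      · rw [hnorm, indicator_of_mem (mem_Iio.2 hx), Complex.norm_exp]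
        simp only [← Complex.ofReal_mul, Complex.ofReal_re]
        gcongr
        exact norm_inPrimitive_le hg x
  set c : ℕ → ℝ → ℂ := fun n k => damping n - Complex.I * k
  have hcre : ∀ n k, 0 < (c n k).re := fun n k => by simpa [c] using damping_pos n
  have hcne : ∀ n k, c n k ≠ 0 := fun n k h => by
    have := hcre n k
    rw [h] at this
    simp at this
  have hFT : ∀ n k, outFT (un n) k = ((Real.sqrt (2 * Real.pi))⁻¹ : ℝ) *
      (-(∫ y, Complex.exp (c n k * xIn y) * g y) / c n k) := by
    intro n k
    have hprod : Integrable (Function.uncurry fun x y : ℝ => Complex.exp (c n k * x) *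
        {z : ℝ × ℝ | xIn z.2 < z.1 ∧ z.1 < 0}.indicator (fun z => g z.2) (x, y))
        (volume.prod volume) := by
      refine (((integrable_indicator_exp (hcre n k)).mul_prod hg).indicator
        measurableSet_inRegion).congr (ae_of_all _ fun z => ?_)
      obtain ⟨x, y⟩ := z
      by_cases h : xIn y < x ∧ x < 0 <;> simp [indicator, h, Function.uncurry]
    have hexp_i : Integrable fun y => Complex.exp (c n k * xIn y) * g y := by
      refine hg.bdd_mul (c := 1) (Continuous.aestronglyMeasurable (by fun_prop))
        (ae_of_all _ fun y => ?_)
      rw [Complex.norm_exp, Real.exp_le_one_iff]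
      have : (c n k * xIn y).re = (c n k).re * xIn y := by simp [Complex.mul_re]
      rw [this]
      exact mul_nonpos_of_nonneg_of_nonpos (hcre n k).le (xIn_neg y).le
    rw [outFT]
    congr 1
    calc ∫ x : ℝ, Complex.exp (-(Complex.I * k * x)) * un n x
        = ∫ x : ℝ, ∫ y : ℝ, Complex.exp (c n k * x) *
          {z : ℝ × ℝ | xIn z.2 < z.1 ∧ z.1 < 0}.indicator (fun z => g z.2) (x, y) := by
          refine integral_congr_ae (ae_of_all _ fun x => ?_)
          simp only
          rw [integral_const_mul, ← inPrimitive, ← mul_assoc, ← Complex.exp_add]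
          congr 2
          simp only [c]
          ring
      _ = ∫ y : ℝ, ∫ x : ℝ, Complex.exp (c n k * x) *
          {z : ℝ × ℝ | xIn z.2 < z.1 ∧ z.1 < 0}.indicator (fun z => g z.2) (x, y) :=
          integral_integral_swap hprod
      _ = _ := by
          simp only [integral_exp_mul_inRegion (hcne n k)]
          rw [integral_div, integral_sub hg hexp_i, h0, zero_sub]
  have hlim : ∀ᵐ k : ℝ, Tendsto (fun n => outFT (un n) k) atTop
      (𝓝 (inFT g k / (Complex.I * k))) := by
    filter_upwards [ae_ne_zero] with k hk
    simp only [hFT]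
    have hc : Tendsto (fun n => c n k) atTop (𝓝 (-(Complex.I * k))) := by
      simpa [c] using tendsto_damping_complex.sub_const (Complex.I * k)
    have h1 : Tendsto (fun n => ∫ y, Complex.exp (c n k * xIn y) * g y) atTop
        (𝓝 (∫ y, Complex.exp (-(Complex.I * k * xIn y)) * g y)) := by
      refine tendsto_integral_of_dominated_convergence (fun y => ‖g y‖) (fun n => ?_) hg.norm
        (fun n => ae_of_all _ fun y => ?_) (ae_of_all _ fun y => ?_)
      · exact (Continuous.aestronglyMeasurable (by fun_prop)).mul hg.aestronglyMeasurable
      · rw [norm_mul, Complex.norm_exp]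
        refine mul_le_of_le_one_left (norm_nonneg _) (Real.exp_le_one_iff.2 ?_)
        have : (c n k * xIn y).re = (c n k).re * xIn y := by simp [Complex.mul_re]
        rw [this]
        exact mul_nonpos_of_nonneg_of_nonpos (hcre n k).le (xIn_neg y).le
      · have := ((hc.mul_const (xIn y : ℂ)).cexp).mul_const (g y)
        simpa using this
    have hne : -(Complex.I * k : ℂ) ≠ 0 := by simp [hk]
    have h3 := ((h1.neg.div hc hne).const_mul (((Real.sqrt (2 * Real.pi))⁻¹ : ℝ) : ℂ))
    have e : inFT g k / (Complex.I * k) = ((Real.sqrt (2 * Real.pi))⁻¹ : ℝ) *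
        (-(∫ y, Complex.exp (-(Complex.I * k * xIn y)) * g y) / -(Complex.I * k)) := by
      rw [inFT, neg_div_neg_eq, mul_div_assoc]
    rw [e]
    exact h3
  have := lintegral_enorm_limit_outFT_sq_le hun_i
    (fun n x => (hle n x).trans (norm_inPrimitive_le hg x)) hle hlim
  refine le_trans (le_of_eq (lintegral_congr fun k => ?_)) this
  congr 1
  rw [← ofReal_norm, ← ofReal_norm, ← ENNReal.ofReal_mul (norm_nonneg _)]
  congr 1
  simp [div_eq_mul_inv]

/-- The substitution `x = x(y)` maps the line onto `x < 0`, where the primitive lives; the weight is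
`x'(y)`. -/
theorem lintegral_enorm_inFT_div_sq_le {g : ℝ → ℂ} (hg : Integrable g) (h0 : ∫ y, g y = 0) :
    ∫⁻ k, (‖inFT g k‖ₑ * ENNReal.ofReal (1 / |k|)) ^ 2 ≤
      ∫⁻ y, ENNReal.ofReal (1 / (1 + Real.exp y)) * ‖∫ t in Iio y, g t‖ₑ ^ 2 := by
  refine (lintegral_enorm_inFT_div_sq_le_inPrimitive hg h0).trans (le_of_eq ?_)
  calc ∫⁻ x, ‖inPrimitive g x‖ₑ ^ 2 = ∫⁻ x in xIn '' univ, ‖inPrimitive g x‖ₑ ^ 2 := by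
        rw [image_univ, range_xIn, ← lintegral_indicator measurableSet_Iio]
        refine lintegral_congr fun x => ?_
        by_cases h : x < 0
        · simp [indicator, h]
        · simp [indicator, h, inPrimitive_of_nonneg g (not_lt.1 h)]
    _ = _ := by
        rw [lintegral_image_eq_lintegral_abs_deriv_mul MeasurableSet.univ
          (fun y _ => (hasDerivAt_xIn y).hasDerivWithinAt) strictMono_xIn.injective.injOn,
          Measure.restrict_univ]
        refine lintegral_congr fun y => ?_
        rw [inPrimitive_xIn, abs_of_pos (by positivity)]

/-- The part of the thermal mean that is not produced spontaneously. -/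
theorem lintegral_bose_le {h : ℝ → ℂ} (hh : Continuous h) {β : ℝ} (hβ : 0 < β) :
    (∫⁻ k in Ioi (0 : ℝ), ENNReal.ofReal (‖h k‖ ^ 2 * (1 / (Real.exp (β * k) - 1)) / (2 * k))) +
      ∫⁻ k in Ioi (0 : ℝ), ENNReal.ofReal
        (‖h (-k)‖ ^ 2 * (1 / (Real.exp (β * k) - 1)) / (2 * k)) ≤
      ENNReal.ofReal (1 / (2 * β)) * ∫⁻ k, (‖h k‖ₑ * ENNReal.ofReal (1 / |k|)) ^ 2 := by
  set q : ℝ → ℝ≥0∞ := fun k => (‖h k‖ₑ * ENNReal.ofReal (1 / |k|)) ^ 2 with hq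
  have hmeas : Measurable q := by
    have := hh.measurable.enorm
    fun_prop
  have key : ∀ k > 0, ∀ z : ℂ, ENNReal.ofReal
      (‖z‖ ^ 2 * (1 / (Real.exp (β * k) - 1)) / (2 * k)) ≤
      ENNReal.ofReal (1 / (2 * β)) * (‖z‖ₑ * ENNReal.ofReal (1 / k)) ^ 2 := by
    intro k hk z
    rw [← ofReal_norm, ← ENNReal.ofReal_mul (norm_nonneg _), ← ENNReal.ofReal_pow (by positivity),
      ← ENNReal.ofReal_mul (by positivity)]
    refine ENNReal.ofReal_le_ofReal ?_
    -- The Bose factor is at most its infrared form `1/(βk)`.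
    have h1 : β * k ≤ Real.exp (β * k) - 1 := by linarith [Real.add_one_le_exp (β * k)]
    have h2 : 1 / (Real.exp (β * k) - 1) ≤ 1 / (β * k) :=
      one_div_le_one_div_of_le (by positivity) h1
    calc ‖z‖ ^ 2 * (1 / (Real.exp (β * k) - 1)) / (2 * k) ≤ ‖z‖ ^ 2 * (1 / (β * k)) / (2 * k) := by
          gcongr
      _ = _ := by field_simp
  have e : ∫⁻ k, q k = (∫⁻ k in Ioi (0 : ℝ), q k) + ∫⁻ k in Ioi (0 : ℝ), q (-k) := by
    have h1 := lintegral_add_compl q (measurableSet_Ioi (a := (0 : ℝ))) (μ := volume)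
    rw [← h1]
    congr 1
    rw [compl_Ioi, setLIntegral_congr Iio_ae_eq_Iic.symm]
    have h2 := (Measure.measurePreserving_neg (volume : Measure ℝ)).setLIntegral_comp_preimage
      (s := Iio 0) measurableSet_Iio hmeas
    rw [← h2]
    simp
  rw [e, mul_add]
  gcongr ?_ + ?_
  · rw [← lintegral_const_mul _ hmeas]
    refine setLIntegral_mono' measurableSet_Ioi fun k hk => ?_
    have hk : 0 < k := hk
    simpa [hq, abs_of_pos hk] using key k hk (h k)
  · have hmeas' : Measurable fun k => q (-k) := hmeas.comp measurable_neg
    rw [← lintegral_const_mul _ hmeas']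
    refine setLIntegral_mono' measurableSet_Ioi fun k hk => ?_
    have hk : 0 < k := hk
    simpa [hq, abs_of_pos hk] using key k hk (h (-k))

end Infrared

/-! ### Translates, and the decay of the primitive -/

section Translates

theorem outFT_shift (f : ℝ → ℂ) (yo p : ℝ) :
    outFT (shift f yo) p = Complex.exp (-(Complex.I * p * yo)) * outFT f p := by
  have h := integral_sub_right_eq_self (μ := volume)
    (fun y : ℝ => Complex.exp (-(Complex.I * p * (y + yo : ℝ))) * f y) yo
  simp only [sub_add_cancel] at h
  unfold outFT shift
  rw [h, mul_left_comm, ← integral_const_mul (Complex.exp (-(Complex.I * p * yo)))]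
  congr 1
  refine integral_congr_ae (ae_of_all _ fun y => ?_)
  simp only [← mul_assoc, ← Complex.exp_add]
  congr 2
  push_cast; ring

theorem norm_outFT_shift (f : ℝ → ℂ) (yo p : ℝ) : ‖outFT (shift f yo) p‖ = ‖outFT f p‖ := by
  rw [outFT_shift, norm_mul, Complex.norm_exp]
  simp

theorem primitiveNorm_shift (f : ℝ → ℂ) (yo : ℝ) : primitiveNorm (shift f yo) = primitiveNorm f := by
  unfold primitiveNorm
  simp only [← ofReal_norm, norm_outFT_shift]

theorem integrable_shift {f : ℝ → ℂ} (hf : Integrable f) (yo : ℝ) : Integrable (shift f yo) :=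
  hf.comp_sub_right yo

theorem setIntegral_Iio_shift (f : ℝ → ℂ) (yo y : ℝ) :
    ∫ t in Iio y, shift f yo t = ∫ t in Iio (y - yo), f t := by
  rw [← integral_indicator measurableSet_Iio, ← integral_indicator measurableSet_Iio,
    ← integral_sub_right_eq_self (μ := volume) ((Iio (y - yo)).indicator f) yo]
  refine integral_congr_ae (ae_of_all _ fun t => ?_)
  simp [indicator, shift]

/-- The transform is continuous and vanishes to the left of `0`, hence at `0`. -/
theorem integral_eq_zero_of_outFT {f : ℝ → ℂ} (hf : Integrable f)
    (hpos : ∀ p < 0, outFT f p = 0) : ∫ y, f y = 0 := by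
  have h1 : outFT f 0 = 0 := by
    have hc := (continuous_outFT hf).continuousWithinAt (s := Iio 0) (x := 0)
    refine tendsto_nhds_unique hc (Tendsto.congr' ?_ tendsto_const_nhds)
    filter_upwards [self_mem_nhdsWithin] with p hp using (hpos p hp).symm
  have hs : (((Real.sqrt (2 * Real.pi))⁻¹ : ℝ) : ℂ) ≠ 0 := by
    have : (0 : ℝ) < Real.sqrt (2 * Real.pi) := by positivity
    exact_mod_cast (inv_pos.2 this).ne'
  unfold outFT at h1
  simpa using (mul_eq_zero.1 h1).resolve_left hs

/-- From `1 - e^{-2πp} ≤ 2πp` and `1/p² = 4π / (2p · 2πp)`. -/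
theorem primitiveNorm_le_thermalIntegral {f : ℝ → ℂ} (hpos : ∀ p < 0, outFT f p = 0) :
    primitiveNorm f ≤ ENNReal.ofReal (4 * Real.pi) * thermalIntegral f := by
  have e : primitiveNorm f =
      ∫⁻ p in Ioi (0 : ℝ), (‖outFT f p‖ₑ * ENNReal.ofReal (1 / |p|)) ^ 2 := by
    rw [← lintegral_indicator measurableSet_Ioi, primitiveNorm]
    refine lintegral_congr fun p => ?_
    rcases lt_trichotomy p 0 with h | h | h
    · simp [indicator, hpos p h]
    · simp [h]
    · simp [indicator, h]
  rw [e, thermalIntegral, ← lintegral_const_mul' _ _ ENNReal.ofReal_ne_top]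
  refine setLIntegral_mono' measurableSet_Ioi fun p hp => ?_
  have hp : 0 < p := hp
  rw [← ofReal_norm, ← ENNReal.ofReal_mul (norm_nonneg _), ← ENNReal.ofReal_pow (by positivity),
    ← ENNReal.ofReal_mul (by positivity), abs_of_pos hp]
  refine ENNReal.ofReal_le_ofReal ?_
  have h1 : 1 - Real.exp (-(2 * Real.pi * p)) ≤ 2 * Real.pi * p := by
    linarith [Real.add_one_le_exp (-(2 * Real.pi * p))]
  have h2 : 0 < 1 - Real.exp (-(2 * Real.pi * p)) := by
    have : Real.exp (-(2 * Real.pi * p)) < 1 := Real.exp_lt_one_iff.2 (by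
      have : 0 < 2 * Real.pi * p := by positivity
      linarith)
    linarith
  calc (‖outFT f p‖ * (1 / p)) ^ 2
      = 4 * Real.pi * (‖outFT f p‖ ^ 2 / (2 * p * (2 * Real.pi * p))) := by
        field_simp; ring
    _ ≤ _ := by gcongr

theorem integrableOn_neg_rpow {b c : ℝ} (hb : 1 < b) (hc : 0 < c) :
    IntegrableOn (fun t : ℝ => (-t) ^ (-b)) (Iic (-c)) := by
  have h := integrableOn_Ioi_rpow_of_lt (by linarith : -b < -1) hc
  have := (Measure.measurePreserving_neg (volume : Measure ℝ)).integrableOn_comp_preimage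
    (MeasurableEquiv.neg ℝ).measurableEmbedding (f := fun t : ℝ => t ^ (-b)) (s := Ioi c)
  have h2 := this.2 h
  rw [IntegrableOn, Measure.restrict_congr_set Iio_ae_eq_Iic.symm]
  simpa [Function.comp_def, IntegrableOn] using h2

theorem integral_neg_rpow {b c : ℝ} (hb : 1 < b) (hc : 0 < c) :
    ∫ t in Iic (-c), (-t) ^ (-b) = 1 / ((b - 1) * c ^ (b - 1)) := by
  rw [integral_comp_neg_Iic (-c) (fun t : ℝ => t ^ (-b)), neg_neg,
    integral_Ioi_rpow_of_lt (by linarith) hc, show -b + 1 = -(b - 1) by ring,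
    Real.rpow_neg hc.le, neg_div_neg_eq]
  have : 0 < c ^ (b - 1) := Real.rpow_pos_of_pos hc _
  have : b - 1 ≠ 0 := by linarith
  field_simp

variable {f : ℝ → ℂ} {α C L : ℝ}

theorem norm_primitive_le (hα : 1 / 2 < α) (hL : 1 ≤ L)
    (hdecay : ∀ᵐ y : ℝ, y ≤ -L → ‖f y‖ ≤ C / |y| ^ (1 + α)) {t : ℝ} (ht : t ≤ -L) :
    ‖∫ y in Iio t, f y‖ ≤ C / α * (-t) ^ (-α) := by
  have ht0 : 0 < -t := by linarith
  have hi := integrableOn_neg_rpow (by linarith : 1 < 1 + α) ht0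
  have hv := integral_neg_rpow (by linarith : 1 < 1 + α) ht0
  rw [neg_neg] at hi hv
  rw [setIntegral_congr_set Iio_ae_eq_Iic]
  have : ‖∫ y in Iic t, f y‖ ≤ ∫ y in Iic t, C * (-y) ^ (-(1 + α)) := by
    refine norm_integral_le_of_norm_le (hi.const_mul C) ?_
    rw [ae_restrict_iff' measurableSet_Iic]
    filter_upwards [hdecay] with y hy hyt
    have hyt : y ≤ t := hyt
    have h1 := hy (hyt.trans ht)
    rw [abs_of_neg (by linarith)] at h1
    rwa [Real.rpow_neg (by linarith), ← div_eq_mul_inv]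
  refine this.trans (le_of_eq ?_)
  rw [integral_const_mul, hv, Real.rpow_neg ht0.le]
  simp only [add_sub_cancel_left]
  have : 0 < (-t) ^ α := Real.rpow_pos_of_pos ht0 _
  have : α ≠ 0 := by linarith
  field_simp

theorem lintegral_primitive_le (hf : Integrable f) (hα : 1 / 2 < α) (hL : 1 ≤ L)
    (hdecay : ∀ᵐ y : ℝ, y ≤ -L → ‖f y‖ ≤ C / |y| ^ (1 + α)) {yo : ℝ} (hyo : 0 < yo) :
    ∫⁻ t, ENNReal.ofReal (1 / (1 + Real.exp (t + yo))) * ‖∫ y in Iio t, f y‖ₑ ^ 2 ≤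
      ENNReal.ofReal (C ^ 2 / (α ^ 2 * (2 * α - 1) * (yo / 2 + L) ^ (2 * α - 1))) +
        ENNReal.ofReal (Real.exp (L - yo / 2)) * primitiveNorm f := by
  -- Cutting halfway makes both sides small: for `t ≤ -a` the decay applies far out, while for `t >
  -- -a` one has `t + yo > yo/2 - L` and the weight is exponentially small.
  set a := yo / 2 + L with ha
  have ha0 : 0 < a := by linarith
  rw [← lintegral_add_compl _ (measurableSet_Iic (a := -a))]
  gcongr ?_ + ?_
  · calc _ ≤ ∫⁻ t in Iic (-a), ENNReal.ofReal (C ^ 2 / α ^ 2 * (-t) ^ (-(2 * α))) := by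
          refine setLIntegral_mono' measurableSet_Iic fun t ht => ?_
          have ht : t ≤ -a := ht
          have ht0 : 0 < -t := by linarith
          have h1 := norm_primitive_le hα hL hdecay (by linarith : t ≤ -L)
          rw [← ofReal_norm, ← ENNReal.ofReal_pow (norm_nonneg _),
            ← ENNReal.ofReal_mul (by positivity)]
          refine ENNReal.ofReal_le_ofReal ?_
          have h2 : 1 / (1 + Real.exp (t + yo)) ≤ 1 := by
            rw [div_le_one (by positivity)]
            linarith [Real.exp_pos (t + yo)]
          calc _ ≤ 1 * (C / α * (-t) ^ (-α)) ^ 2 := by gcongr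
            _ = _ := by
              rw [one_mul, mul_pow, div_pow, ← Real.rpow_natCast ((-t) ^ (-α)),
                ← Real.rpow_mul ht0.le]
              congr 2
              push_cast; ring
    _ = ENNReal.ofReal (∫ t in Iic (-a), C ^ 2 / α ^ 2 * (-t) ^ (-(2 * α))) := by
          refine (ofReal_integral_eq_lintegral_ofReal
            ((integrableOn_neg_rpow (by linarith) ha0).const_mul _) ?_).symm
          refine (ae_restrict_iff' measurableSet_Iic).2 (ae_of_all _ fun t ht => ?_)
          have ht : t ≤ -a := ht
          have : 0 < (-t) ^ (-(2 * α)) := Real.rpow_pos_of_pos (by linarith) _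
          exact mul_nonneg (by positivity) this.le
    _ = _ := by
          rw [integral_const_mul, integral_neg_rpow (by linarith) ha0]
          congr 1
          have : α ≠ 0 := by linarith
          have : 2 * α - 1 ≠ 0 := by linarith
          have := Real.rpow_pos_of_pos ha0 (2 * α - 1)
          field_simp
  · calc _ ≤ ∫⁻ t in (Iic (-a))ᶜ,
          ENNReal.ofReal (Real.exp (L - yo / 2)) * ‖∫ y in Iio t, f y‖ₑ ^ 2 := by
          refine setLIntegral_mono' measurableSet_Iic.compl fun t ht => ?_
          have ht : -a < t := by simpa using ht
          gcongr
          rw [div_le_iff₀ (by positivity)]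
          have h1 : 1 ≤ Real.exp (L - yo / 2) * Real.exp (t + yo) := by
            rw [← Real.exp_add]
            exact Real.one_le_exp (by linarith)
          nlinarith [Real.exp_pos (L - yo / 2)]
    _ ≤ ∫⁻ t, ENNReal.ofReal (Real.exp (L - yo / 2)) * ‖∫ y in Iio t, f y‖ₑ ^ 2 :=
          setLIntegral_le_lintegral _ _
    _ ≤ _ := by
          rw [lintegral_const_mul' _ _ ENNReal.ofReal_ne_top]
          gcongr
          exact lintegral_enorm_primitive_sq_le hf

end Translates

/-! ### The mean numbers -/

section MeanNumbers

/-- The mean number in the incoming vacuum. -/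
noncomputable def spontaneousNumber (g : ℝ → ℂ) : ℝ≥0∞ :=
  ∫⁻ k in Ioi (0 : ℝ), ENNReal.ofReal (‖inFT g (-k)‖ ^ 2 * 1 / (2 * k))

/-- The excess of the mean number in the incoming thermal state. -/
noncomputable def stimulatedNumber (β : ℝ) (g : ℝ → ℂ) : ℝ≥0∞ :=
  (∫⁻ k in Ioi (0 : ℝ), ENNReal.ofReal
      (‖inFT g k‖ ^ 2 * (1 / (Real.exp (β * k) - 1)) / (2 * k))) +
    ∫⁻ k in Ioi (0 : ℝ), ENNReal.ofReal
      (‖inFT g (-k)‖ ^ 2 * (1 / (Real.exp (β * k) - 1)) / (2 * k))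

variable {g : ℝ → ℂ}

theorem isSpontaneousNumber (s : FieldKind) (hg : Integrable g) :
    IsSpontaneousNumber s g (spontaneousNumber g) := by
  have := tendsto_cellSum (h := fun k => inFT g (-k)) (q := fun _ => 1)
    ((continuous_inFT hg).comp continuous_neg) (fun _ _ => zero_le_one)
    antitoneOn_const continuousOn_const
  unfold IsSpontaneousNumber
  simp only [vacuumMean_numberOp]
  simpa only [spontaneousNumber, mul_one] using this

theorem bose_pos {β : ℝ} (hβ : 0 < β) {k : ℝ} (hk : 0 < k) : 0 < Real.exp (β * k) - 1 := by
  have := Real.one_lt_exp_iff.2 (mul_pos hβ hk)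
  linarith

theorem isThermalNumber (s : FieldKind) {β : ℝ} (hβ : 0 < β) (hg : Integrable g) :
    IsThermalNumber s β g (spontaneousNumber g + stimulatedNumber β g) := by
  have hq0 : ∀ k, 0 < k → 0 ≤ 1 / (Real.exp (β * k) - 1) := fun k hk =>
    (one_div_pos.2 (bose_pos hβ hk)).le
  have hqa : AntitoneOn (fun k => 1 / (Real.exp (β * k) - 1)) (Ioi 0) := fun a ha b _ hab =>
    one_div_le_one_div_of_le (bose_pos hβ ha) (by gcongr)
  have hqc : ContinuousOn (fun k => 1 / (Real.exp (β * k) - 1)) (Ioi 0) :=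
    continuousOn_const.div (by fun_prop) fun k hk => (bose_pos hβ hk).ne'
  have hc := continuous_inFT hg
  have h1 := tendsto_cellSum hc hq0 hqa hqc
  have h2 := tendsto_cellSum (hc.comp continuous_neg) hq0 hqa hqc
  have h3 := isSpontaneousNumber s hg
  unfold IsSpontaneousNumber at h3
  simp only [vacuumMean_numberOp] at h3
  unfold IsThermalNumber
  simp only [gibbsMean_numberOp s _ _ _ hβ]
  -- The `+1` in `aa†` is the vacuum sum; the two Bose-weighted sums make up the excess.
  refine (h3.add (h1.add h2)).congr fun r => ?_
  have hb : ∀ j : Fin (r.1 * r.2), 0 ≤ 1 / (Real.exp (β * cellFrequency r.1 j) - 1) := fun j => by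
    refine hq0 _ ?_
    have hm : 0 < r.1 := by
      rcases Nat.eq_zero_or_pos r.1 with h | h
      · exact absurd j.2 (by simp [h])
      · exact h
    simp only [cellFrequency]
    positivity
  have hs : ∀ c : Fin (r.1 * r.2) → ℂ, 0 ≤ ∑ j, ‖c j‖ ^ 2 *
      (1 / (Real.exp (β * cellFrequency r.1 j) - 1)) := fun c =>
    Finset.sum_nonneg fun j _ => mul_nonneg (sq_nonneg _) (hb j)
  rw [← ENNReal.ofReal_add (hs _) (hs _),
    ← ENNReal.ofReal_add (Finset.sum_nonneg fun j _ => sq_nonneg _) (add_nonneg (hs _) (hs _)),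
    ← Finset.sum_add_distrib, ← Finset.sum_add_distrib]
  congr 1
  refine Finset.sum_congr rfl fun j _ => ?_
  simp only [Function.comp_def]
  ring

theorem spontaneousNumber_le (hg : Integrable g) (hpos : ∀ p < 0, outFT g p = 0) :
    spontaneousNumber g ≤ primitiveNorm g := by
  refine le_trans (setLIntegral_mono' measurableSet_Ioi fun k hk => ?_)
    (lintegral_enorm_inFT_neg_le_primitiveNorm hg hpos)
  have hk : 0 < k := hk
  rw [← ofReal_norm, ← ENNReal.ofReal_pow (norm_nonneg _), ← ENNReal.ofReal_mul (by positivity)]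
  refine ENNReal.ofReal_le_ofReal ?_
  rw [mul_div_assoc]
  gcongr
  linarith

theorem stimulatedNumber_shift_le {f : ℝ → ℂ} {α C L β : ℝ} (hβ : 0 < β) (hf : Integrable f)
    (hpos : ∀ p < 0, outFT f p = 0) (hα : 1 / 2 < α) (hL : 1 ≤ L)
    (hdecay : ∀ᵐ y : ℝ, y ≤ -L → ‖f y‖ ≤ C / |y| ^ (1 + α)) {yo : ℝ} (hyo : 0 < yo) :
    stimulatedNumber β (shift f yo) ≤
      ENNReal.ofReal (C ^ 2 / (β * α ^ 2 * (2 * α - 1) * (yo / 2 + L) ^ (2 * α - 1))) +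
        ENNReal.ofReal (4 * Real.pi / β * Real.exp (L - yo / 2)) * thermalIntegral f := by
  have hg := integrable_shift hf yo
  have hgpos : ∀ p < 0, outFT (shift f yo) p = 0 := fun p hp => by
    rw [outFT_shift, hpos p hp, mul_zero]
  have h0 := integral_eq_zero_of_outFT hg hgpos
  have ha0 : 0 < yo / 2 + L := by linarith
  have hrpow := Real.rpow_pos_of_pos ha0 (2 * α - 1)
  have hα1 : 0 < 2 * α - 1 := by linarith
  have hα0 : 0 < α := by linarith
  calc stimulatedNumber β (shift f yo)
      ≤ ENNReal.ofReal (1 / (2 * β)) *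
          ∫⁻ k, (‖inFT (shift f yo) k‖ₑ * ENNReal.ofReal (1 / |k|)) ^ 2 :=
        lintegral_bose_le (continuous_inFT hg) hβ
    _ ≤ ENNReal.ofReal (1 / (2 * β)) * ∫⁻ y, ENNReal.ofReal (1 / (1 + Real.exp y)) *
          ‖∫ t in Iio y, shift f yo t‖ₑ ^ 2 := by
        exact mul_le_mul' le_rfl (lintegral_enorm_inFT_div_sq_le hg h0)
    _ = ENNReal.ofReal (1 / (2 * β)) * ∫⁻ t, ENNReal.ofReal (1 / (1 + Real.exp (t + yo))) *
          ‖∫ y in Iio t, f y‖ₑ ^ 2 := by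
        congr 1
        rw [← lintegral_sub_right_eq_self (μ := volume) (fun t =>
          ENNReal.ofReal (1 / (1 + Real.exp (t + yo))) * ‖∫ y in Iio t, f y‖ₑ ^ 2) yo]
        simp only [sub_add_cancel, setIntegral_Iio_shift]
    _ ≤ ENNReal.ofReal (1 / (2 * β)) *
          (ENNReal.ofReal (C ^ 2 / (α ^ 2 * (2 * α - 1) * (yo / 2 + L) ^ (2 * α - 1))) +
            ENNReal.ofReal (Real.exp (L - yo / 2)) *
              (ENNReal.ofReal (4 * Real.pi) * thermalIntegral f)) := by
        gcongr
        refine (lintegral_primitive_le hf hα hL hdecay hyo).trans ?_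
        gcongr
        exact primitiveNorm_le_thermalIntegral hpos
    _ ≤ _ := by
        rw [mul_add, ← ENNReal.ofReal_mul (by positivity), ← mul_assoc, ← mul_assoc,
          ← ENNReal.ofReal_mul (by positivity), ← ENNReal.ofReal_mul (by positivity)]
        -- The factor `1/(2β)` yields half of each stated constant, so the bound has a factor two to
        -- spare.
        gcongr ENNReal.ofReal ?_ + ENNReal.ofReal ?_ * _
        · calc _ = C ^ 2 / (β * α ^ 2 * (2 * α - 1) * (yo / 2 + L) ^ (2 * α - 1)) / 2 := by
                field_simp
            _ ≤ _ := half_le_self (by positivity)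
        · calc _ = 4 * Real.pi / β * Real.exp (L - yo / 2) / 2 := by field_simp
            _ ≤ _ := half_le_self (by positivity)

theorem tendsto_bound_zero {α C L β I : ℝ} (hα : 1 / 2 < α) :
    Tendsto (fun yo : ℝ => C ^ 2 / (β * α ^ 2 * (2 * α - 1) * (yo / 2 + L) ^ (2 * α - 1)) +
      4 * Real.pi / β * Real.exp (L - yo / 2) * I) atTop (𝓝 0) := by
  have h1 : Tendsto (fun yo : ℝ => yo / 2 + L) atTop atTop :=
    tendsto_atTop_add_const_right _ _ (tendsto_id.atTop_div_const two_pos)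
  have h2 : Tendsto (fun yo : ℝ => ((yo / 2 + L) ^ (2 * α - 1))⁻¹) atTop (𝓝 0) :=
    ((tendsto_rpow_atTop (by linarith : 0 < 2 * α - 1)).comp h1).inv_tendsto_atTop
  have h3 : Tendsto (fun yo : ℝ => Real.exp (L - yo / 2)) atTop (𝓝 0) := by
    refine Real.tendsto_exp_atBot.comp ?_
    exact tendsto_atBot_add_const_left _ L
      (tendsto_neg_atTop_atBot.comp (tendsto_id.atTop_div_const two_pos))
  have := (h2.const_mul (C ^ 2 / (β * α ^ 2 * (2 * α - 1)))).add
    ((h3.const_mul (4 * Real.pi / β)).mul_const I)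
  simp only [mul_zero, zero_mul, add_zero] at this
  refine this.congr fun yo => ?_
  rw [← div_eq_mul_inv, div_div]

end MeanNumbers

end CGHS

theorem mainTheorem8 (s : CGHS.FieldKind) (β : ℝ) (hβ : 0 < β)
    (f : ℝ → ℂ) (hf : CGHS.IsNormalizedWave f)
    (α C L : ℝ) (hα : 1 / 2 < α) (hC : 0 < C) (hL : 1 ≤ L)
    (hdecay : ∀ᵐ y : ℝ, y ≤ -L → ‖f y‖ ≤ C / |y| ^ (1 + α)) :
    ∃ Nth No : ℝ → ℝ≥0∞,
      (∀ yo : ℝ, CGHS.IsThermalNumber s β (CGHS.shift f yo) (Nth yo)) ∧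
      (∀ yo : ℝ, CGHS.IsSpontaneousNumber s (CGHS.shift f yo) (No yo)) ∧
      -- the bound on the difference, in `[0, ∞]`
      (∀ yo : ℝ, 0 < yo → ∀ R : ℝ≥0∞,
        R = ENNReal.ofReal (C ^ 2 / (β * α ^ 2 * (2 * α - 1) * (yo / 2 + L) ^ (2 * α - 1))) +
            ENNReal.ofReal (4 * Real.pi / β * Real.exp (L - yo / 2)) * CGHS.thermalIntegral f →
        Nth yo ≤ No yo + R ∧ No yo ≤ Nth yo + R) ∧
      -- if the right-hand side is finite, so are both numbers, and their difference tends to zero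
      (CGHS.thermalIntegral f < ∞ →
        (∀ yo : ℝ, 0 < yo → Nth yo < ∞ ∧ No yo < ∞ ∧
          |(Nth yo).toReal - (No yo).toReal| ≤
            C ^ 2 / (β * α ^ 2 * (2 * α - 1) * (yo / 2 + L) ^ (2 * α - 1)) +
              4 * Real.pi / β * Real.exp (L - yo / 2) * (CGHS.thermalIntegral f).toReal) ∧
        Tendsto (fun yo : ℝ => (Nth yo).toReal - (No yo).toReal) atTop (𝓝 0)) := by
  have hi := hf.integrable
  have hpos := hf.positive_momentum
  have hD := fun (yo : ℝ) (hyo : 0 < yo) =>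
    CGHS.stimulatedNumber_shift_le hβ hi hpos hα hL hdecay hyo
  refine ⟨fun yo => CGHS.spontaneousNumber (CGHS.shift f yo) +
    CGHS.stimulatedNumber β (CGHS.shift f yo), fun yo => CGHS.spontaneousNumber (CGHS.shift f yo),
    fun yo => CGHS.isThermalNumber s hβ (CGHS.integrable_shift hi yo),
    fun yo => CGHS.isSpontaneousNumber s (CGHS.integrable_shift hi yo), ?_, fun hI => ?_⟩
  · rintro yo hyo R rfl
    -- The excess is nonnegative, so only the first inequality carries content.
    exact ⟨add_le_add le_rfl (hD yo hyo), le_add_right le_self_add⟩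
  have hfin : ∀ yo : ℝ, 0 < yo →
      CGHS.spontaneousNumber (CGHS.shift f yo) + CGHS.stimulatedNumber β (CGHS.shift f yo) < ∞ ∧
      CGHS.spontaneousNumber (CGHS.shift f yo) < ∞ ∧
      |(CGHS.spontaneousNumber (CGHS.shift f yo) +
          CGHS.stimulatedNumber β (CGHS.shift f yo)).toReal -
        (CGHS.spontaneousNumber (CGHS.shift f yo)).toReal| ≤
        C ^ 2 / (β * α ^ 2 * (2 * α - 1) * (yo / 2 + L) ^ (2 * α - 1)) +
          4 * Real.pi / β * Real.exp (L - yo / 2) * (CGHS.thermalIntegral f).toReal := by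
    intro yo hyo
    have hmul : ∀ c : ℝ, ENNReal.ofReal c * CGHS.thermalIntegral f < ∞ := fun c =>
      ENNReal.mul_lt_top ENNReal.ofReal_lt_top hI
    have hNo : CGHS.spontaneousNumber (CGHS.shift f yo) < ∞ := by
      refine lt_of_le_of_lt (CGHS.spontaneousNumber_le (CGHS.integrable_shift hi yo)
        fun p hp => by rw [CGHS.outFT_shift, hpos p hp, mul_zero]) ?_
      rw [CGHS.primitiveNorm_shift]
      exact lt_of_le_of_lt (CGHS.primitiveNorm_le_thermalIntegral hpos) (hmul _)
    have hR : ENNReal.ofReal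
        (C ^ 2 / (β * α ^ 2 * (2 * α - 1) * (yo / 2 + L) ^ (2 * α - 1))) +
        ENNReal.ofReal (4 * Real.pi / β * Real.exp (L - yo / 2)) * CGHS.thermalIntegral f < ∞ :=
      ENNReal.add_lt_top.2 ⟨ENNReal.ofReal_lt_top, hmul _⟩
    have hst := lt_of_le_of_lt (hD yo hyo) hR
    refine ⟨ENNReal.add_lt_top.2 ⟨hNo, hst⟩, hNo, ?_⟩
    rw [ENNReal.toReal_add hNo.ne hst.ne, add_sub_cancel_left, abs_of_nonneg ENNReal.toReal_nonneg]
    have h := ENNReal.toReal_mono hR.ne (hD yo hyo)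
    have h1 : 0 < 2 * α - 1 := by linarith
    have h2 := Real.rpow_pos_of_pos (by linarith : 0 < yo / 2 + L) (2 * α - 1)
    rwa [ENNReal.toReal_add ENNReal.ofReal_ne_top (hmul _).ne, ENNReal.toReal_mul,
      ENNReal.toReal_ofReal (by positivity), ENNReal.toReal_ofReal (by positivity)] at h
  refine ⟨hfin, ?_⟩
  refine squeeze_zero_norm' ?_
    (CGHS.tendsto_bound_zero (C := C) (L := L) (β := β) (I := (CGHS.thermalIntegral f).toReal) hα)
  filter_upwards [eventually_gt_atTop 0] with yo hyo using (hfin yo hyo).2.2
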